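/- **Setting.** A prototile is a closed topological disk $\operatorname{supp}(p)\subset\mathbb R^2$ with a label; $\mathcal P$ is a finite set of prototiles. A tile is a translate $p+x$. A tiling is a countable set of tiles covering $\mathbb R^2$ with pairwise disjoint interiors. Let $T$ be a tiling with finite local complexity (finitely many two-tile patches up to translation) that is self-similar with expansion factor $\lambda>1$ and substitution $\omega$: $\lambda\,\partial T\subset\partial T$, every prototile occurs in $T$, each $\omega(p)$ is a patch with support $\lambda\operatorname{supp}(p)$, and for each tile $t=p+x\in T$ the tiles of $T$ enclosed by $\lambda\operatorname{supp}(t)$ form the patch $\omega(p)+\lambda x$. For a family $B=(B_p)_{p\in\mathcal P}$ of plane sets, or of patches of scaled tiles, put $\mathcal R(B)_p=\bigcup_{q+d\,\in\,\omega(p)}\lambda^{-1}(B_q+d)$ (union over all $q\in\mathcal P$ and $d\in\mathbb R^2$ with $q+d\in\omega(p)$). The tiles of the patch $\mathcal R^n(\mathcal P)_p$ are the $n$-subtiles of $p$, and $[B]$ denotes the set of $N$-subtiles of $p$ that meet $B$. Let $\sim_T$ be the equivalence relation on $\bigsqcup_p\partial\operatorname{supp}(p)$ generated by $a\sim b$ (for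 $a\in\partial\operatorname{supp}(p)$, $b\in\partial\operatorname{supp}(q)$) if $a+x=b+y$ for some $p+x,\,q+y\in T$; unions of its classes are called $T$-consistent. The vertices of the prototiles are the points equivalent to a boundary point that represents a point of the plane lying in at least three tiles of $T$; the edges of $p$ are the arcs of $\partial\operatorname{supp}(p)$ between neighbouring vertices. A geometric graph $G$ on $\mathcal P$ consists, for each $p$, of an embedding of the topological realization of a finite combinatorial graph $K_p$ without vertices of degree $0$ or $2$ into $\operatorname{supp}(p)$, with image $G_p$. Its vertices on $\partial\operatorname{supp}(p)$ are its boundary vertices, the others are interior vertices. $G$ is $T$-consistent if each $G_p$ meets $\partial\operatorname{supp}(p)$ only in boundary vertices and the set of all boundary vertices is $T$-consistent. A $T$-consistent $G$ is quasi-dual if every $G_p$ is a (connected) tree, each edge of each prototile contains exactly one boundary vertex of $G$ and this vertex lies in the interior of the edge, and every interior vertex has degree at least $3$. For $N\ge1$, a pair $(G,S)$ of $T$-consistent geometric graphs is a recurrent pair with $S\subset\mathcal R^N(G)$ if, in addition to this inclusion, for each $p$ the sets $G_p$ and $S_p$ are embeddings of the same graph $K_p$, with resulting homeomorphism $\widetilde\psi_p=\iota_S\circ\iota_G^{-1}:G_p\to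 S_p$, and a vertex $v$ of $G_p$ is a boundary vertex if and only if $\widetilde\psi_p(v)$ is one, in which case both lie in the same edge of $p$. The map $\widetilde\psi$ is piecewise constant-speed if each edge $e$ of $G$ has finite length and $\widetilde\psi$ multiplies the lengths of all sub-arcs of $e$ by one constant $K_e$. $S$ satisfies the injectivity conditions for $N$-subtiles if for all $p\in\mathcal P$: - (I1) for edges $e\ne f$ of $S_p$, the supports of $[e]$ and $[f]$ have intersecting interiors if and only if $e$ and $f$ share a vertex; - (I2) if edges $e\ne f$ of $S_p$ share a vertex $v$, then $[e]\cap[f]=[v]$ consists of a single subtile, contained in the interior of $\operatorname{supp}(p)$; - (I3) the support of $[S_p]$ contains no vertex of $p$; - (I4) for each edge $e$ of $S_p$, $\operatorname{supp}[e]$ meets $\partial\operatorname{supp}(p)$ if and only if $e$ does, and then $\operatorname{supp}[e]\cap\partial\operatorname{supp}(p)$ is connected. Let $\partial T^{(0)}=\bigcup_{p+x\in T}(G_p+x)$. Define $\psi:\partial T^{(0)}\to\mathbb R^2$ by $\psi(z)=\widetilde\psi_p(z-x)+x$ if $z\in\partial T^{(0)}$ lies in the tile $p+x\in T$, and put $\psi^{(n)}(z)=\lambda^{-Nn}(\lambda^N\psi)^n(z)$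 and $\psi^{(\infty)}=\lim_{n\to\infty}\psi^{(n)}$ (pointwise). **Proposition 5.1.** Let $N\ge1$, let $(G,S)$ be a recurrent pair with $S\subset\mathcal R^N(G)$, and suppose that $G$ is quasi-dual, that $\widetilde\psi:G\to S$ is piecewise constant-speed, and that $S$ satisfies the injectivity conditions (I1)–(I4) for $N$-subtiles. Then $\psi$ is well defined, $\lambda^N\psi$ maps $\partial T^{(0)}$ into itself, the limit $\psi^{(\infty)}(z)$ exists for every $z\in\partial T^{(0)}$, and $\psi^{(\infty)}$ is injective on $\partial T^{(0)}$. -/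

import Mathlib

open Set Filter Topology

/-- The Euclidean plane. -/
abbrev Plane := EuclideanSpace ℝ (Fin 2)

namespace FractalTiling

/-! ### Prototiles, tiles, tilings -/

/-- A closed topological disk in the plane: a homeomorphic image `D` of the closed unit disk
(a continuous injection on the compact disk is a homeomorphism onto its image), the open unit disk
being carried onto the topological interior of `D`, hence the unit circle onto `∂D`.
By invariance of domain every homeomorphism of the closed unit disk onto `D` has the last property,
so these are exactly the subsets of the plane that are homeomorphic to the closed unit disk. -/
def IsClosedDisk (D : Set Plane) : Prop :=
  ∃ f : Plane → Plane,
    ContinuousOn f (Metric.closedBall 0 1) ∧ InjOn f (Metric.closedBall 0 1) ∧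
      f '' Metric.closedBall 0 1 = D ∧ f '' Metric.ball 0 1 = interior D

/-- A set of prototiles, indexed by a type `P`; the index of a prototile serves as its label, so
that different prototiles may have the same shape. -/
structure PrototileSet (P : Type*) where
  supp : P → Set Plane
  isClosedDisk : ∀ p, IsClosedDisk (supp p)

/-- The support of the tile `p + x`. A tile `p + x` is recorded as the pair `(p, x)`. -/
def tileSupp {P : Type*} (Pt : PrototileSet P) (t : P × Plane) : Set Plane :=
  (fun z => z + t.2) '' Pt.supp t.1

/-- The translate `Q + x` of a set of tiles. -/
def translate {P : Type*} (Q : Set (P × Plane)) (x : Plane) : Set (P × Plane) :=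
  (fun t : P × Plane => (t.1, t.2 + x)) '' Q

/-- A tiling of the plane: countably many tiles that cover the plane, with pairwise disjoint
interiors. -/
structure IsTiling {P : Type*} (Pt : PrototileSet P) (T : Set (P × Plane)) : Prop where
  countable : T.Countable
  covers : (⋃ t ∈ T, tileSupp Pt t) = univ
  packing : ∀ s ∈ T, ∀ t ∈ T, s ≠ t →
    interior (tileSupp Pt s) ∩ interior (tileSupp Pt t) = ∅

/-- Finite local complexity: up to translation there are finitely many two-tile patches
`{p + x, q + y}` in `T` (the union of the two supports is connected, so they meet). The
translation class is recorded by `(p, q, y - x)`. -/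
def IsFLC {P : Type*} (Pt : PrototileSet P) (T : Set (P × Plane)) : Prop :=
  {c : P × P × Plane | ∃ s ∈ T, ∃ t ∈ T, s ≠ t ∧ (tileSupp Pt s ∩ tileSupp Pt t).Nonempty ∧
    c = (s.1, t.1, t.2 - s.2)}.Finite

/-- The boundary `∂T` of a tiling. -/
def tilingBoundary {P : Type*} (Pt : PrototileSet P) (T : Set (P × Plane)) : Set Plane :=
  ⋃ t ∈ T, frontier (tileSupp Pt t)

/-! ### Substitutions and self-similar tilings -/

/-- A tiling substitution with expansion factor `lam > 1`: it assigns to every prototile `p` a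
patch `omega p` whose support is `lam • supp p`. -/
structure Substitution {P : Type*} (Pt : PrototileSet P) where
  lam : ℝ
  one_lt_lam : 1 < lam
  omega : P → Finset (P × Plane)
  packing : ∀ p, ∀ s ∈ omega p, ∀ t ∈ omega p, s ≠ t →
    interior (tileSupp Pt s) ∩ interior (tileSupp Pt t) = ∅
  supp_omega : ∀ p, (⋃ t ∈ omega p, tileSupp Pt t) = (fun z => lam • z) '' Pt.supp p

/-- `T` is a self-similar tiling with expansion factor `σ.lam` and its substitution is `σ.omega`:
`λ ∂T ⊆ ∂T`, every prototile occurs in `T`, and for each tile `t = p + x` of `T` the patch of `T`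
enclosed by `λ supp t` is `ω(p) + λ x` (so tiles of the same type enclose equivalent patches). -/
structure IsSelfSimilar {P : Type*} {Pt : PrototileSet P} (σ : Substitution Pt)
    (T : Set (P × Plane)) : Prop where
  boundary : (fun z => σ.lam • z) '' tilingBoundary Pt T ⊆ tilingBoundary Pt T
  occurs : ∀ p, ∃ x, (p, x) ∈ T
  enclosed : ∀ t ∈ T,
    {s | s ∈ T ∧ tileSupp Pt s ⊆ (fun z => σ.lam • z) '' tileSupp Pt t} =
      translate (σ.omega t.1 : Set (P × Plane)) (σ.lam • t.2)

/-- The tiling contraction map on families of plane sets indexed by the prototiles,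
`R(B)_p = ⋃_q λ⁻¹ (B_q + D_{pq})`, where `D_{pq}` is the set of the `d` with `q + d ∈ ω(p)`. -/
def contract {P : Type*} {Pt : PrototileSet P} (σ : Substitution Pt) (B : P → Set Plane) (p : P) :
    Set Plane :=
  ⋃ t ∈ σ.omega p, (fun z => σ.lam⁻¹ • (z + t.2)) '' B t.1

/-- The patch `R^n(Pt)_p` of `n`-subtiles of `p`. The `n`-subtile `λ⁻ⁿ q + z` is recorded as the
pair `(q, z)`; the contraction map sends it to `λ⁻¹ (λ⁻ⁿ q + z + d)`. -/
def subtiles {P : Type*} {Pt : PrototileSet P} (σ : Substitution Pt) : ℕ → P → Set (P × Plane)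
  | 0, p => {(p, 0)}
  | n + 1, p => {s | ∃ t ∈ σ.omega p, ∃ u ∈ subtiles σ n t.1, s = (u.1, σ.lam⁻¹ • (u.2 + t.2))}

/-- The support of the `n`-subtile `λ⁻ⁿ q + z`. -/
def subtileSupp {P : Type*} {Pt : PrototileSet P} (σ : Substitution Pt) (n : ℕ) (s : P × Plane) :
    Set Plane :=
  (fun z => (σ.lam ^ n)⁻¹ • z + s.2) '' Pt.supp s.1

/-- The patch `[B]` of the `n`-subtiles of `p` that meet `B`. -/
def subpatch {P : Type*} {Pt : PrototileSet P} (σ : Substitution Pt) (n : ℕ) (p : P)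
    (B : Set Plane) : Set (P × Plane) :=
  {s | s ∈ subtiles σ n p ∧ (subtileSupp σ n s ∩ B).Nonempty}

/-- The support of the patch `[B]` of the `n`-subtiles of `p` that meet `B`. -/
def subpatchSupp {P : Type*} {Pt : PrototileSet P} (σ : Substitution Pt) (n : ℕ) (p : P)
    (B : Set Plane) : Set Plane :=
  ⋃ s ∈ subpatch σ n p B, subtileSupp σ n s

/-! ### Vertices and edges of prototiles

A point `a` of the disjoint union of the boundaries of the prototiles is recorded as a pair
`(p, a)` with `a ∈ ∂ supp p`. -/

/-- Two boundary points of prototiles meet somewhere in `T`. -/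
def Meets {P : Type*} (Pt : PrototileSet P) (T : Set (P × Plane)) (a b : P × Plane) : Prop :=
  a.2 ∈ frontier (Pt.supp a.1) ∧ b.2 ∈ frontier (Pt.supp b.1) ∧
    ∃ x y, (a.1, x) ∈ T ∧ (b.1, y) ∈ T ∧ a.2 + x = b.2 + y

/-- A set of boundary points of prototiles is `T`-consistent if it is a union of classes of the
equivalence relation generated by `Meets`. -/
def IsConsistentSet {P : Type*} (Pt : PrototileSet P) (T : Set (P × Plane))
    (F : Set (P × Plane)) : Prop :=
  (∀ a ∈ F, a.2 ∈ frontier (Pt.supp a.1)) ∧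
    ∀ a ∈ F, ∀ b, Relation.EqvGen (Meets Pt T) a b → b ∈ F

/-- The natural vertices of the prototiles: they represent points at which at least three tiles
of `T` meet. -/
def naturalVertices {P : Type*} (Pt : PrototileSet P) (T : Set (P × Plane)) : Set (P × Plane) :=
  {a | a.2 ∈ frontier (Pt.supp a.1) ∧
    ∃ x, (a.1, x) ∈ T ∧ 3 ≤ {t | t ∈ T ∧ a.2 + x ∈ tileSupp Pt t}.encard}

/-- The vertices of the prototile `p`, i.e. the part on `p` of the `T`-consistent set generated by
the natural vertices. -/
def tileVertices {P : Type*} (Pt : PrototileSet P) (T : Set (P × Plane)) (p : P) : Set Plane :=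
  {z | ∃ a ∈ naturalVertices Pt T, Relation.EqvGen (Meets Pt T) a (p, z)}

/-- `o` is the interior of an edge of the prototile `p`: a connected component of the boundary of
`p` minus the vertices of `p`. The edge itself is `closure o`, the arc of `∂ supp p` between two
neighbouring vertices. -/
def IsOpenEdge {P : Type*} (Pt : PrototileSet P) (T : Set (P × Plane)) (p : P) (o : Set Plane) :
    Prop :=
  ∃ a ∈ frontier (Pt.supp p) \ tileVertices Pt T p,
    o = connectedComponentIn (frontier (Pt.supp p) \ tileVertices Pt T p) a

/-! ### Geometric graphs -/

/-- The vertex `v` of the topological realization of a graph, in barycentric coordinates. -/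
noncomputable def vertexCoord {V : Type*} (v : V) : V → ℝ :=
  open Classical in Pi.single v 1

/-- The edge `e` of the topological realization of a graph: the segment of all points whose
barycentric coordinates vanish outside `e`. -/
def cell {V : Type*} [Fintype V] (e : Sym2 V) : Set (V → ℝ) :=
  {w | w ∈ stdSimplex ℝ V ∧ ∀ c, w c ≠ 0 → c ∈ e}

/-- The topological realization of a finite graph (without vertices of degree `0`): one segment
for each edge, two segments being glued along their common vertices. -/
def realization {V : Type*} [Fintype V] (K : SimpleGraph V) : Set (V → ℝ) :=
  ⋃ e ∈ K.edgeSet, cell e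

/-- A geometric graph on a prototile set, with underlying finite combinatorial graphs `K p`: an
embedding of the topological realization of each `K p` into `supp p`. There are no vertices of
degree `0` or `2`. (A continuous injection on the compact realization is an embedding; the values
of `ι p` outside the realization play no role.) -/
structure GeomGraph {P : Type*} (Pt : PrototileSet P) {V : P → Type*} [∀ p, Fintype (V p)]
    (K : ∀ p, SimpleGraph (V p)) where
  ι : ∀ p, (V p → ℝ) → Plane
  continuousOn : ∀ p, ContinuousOn (ι p) (realization (K p))
  injOn : ∀ p, InjOn (ι p) (realization (K p))
  mapsTo : ∀ p, MapsTo (ι p) (realization (K p)) (Pt.supp p)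
  degree_ne_zero : ∀ p v, ((K p).neighborSet v).ncard ≠ 0
  degree_ne_two : ∀ p v, ((K p).neighborSet v).ncard ≠ 2

namespace GeomGraph

variable {P : Type*} {Pt : PrototileSet P} {V : P → Type*} [∀ p, Fintype (V p)]
  {K : ∀ p, SimpleGraph (V p)}

/-- The point set `G_p`. -/
def carrier (G : GeomGraph Pt K) (p : P) : Set Plane := G.ι p '' realization (K p)

/-- The edge of `G_p` with end points `e`. -/
def edge (G : GeomGraph Pt K) (p : P) (e : Sym2 (V p)) : Set Plane := G.ι p '' cell e

/-- The vertex `v` of `G_p`. -/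
noncomputable def vertex (G : GeomGraph Pt K) (p : P) (v : V p) : Plane := G.ι p (vertexCoord v)

/-- The parametrization by `[0, 1]` of the edge of `G_p` from `a` to `b`. -/
noncomputable def edgePath (G : GeomGraph Pt K) (p : P) (a b : V p) (s : ℝ) : Plane :=
  G.ι p ((1 - s) • vertexCoord a + s • vertexCoord b)

/-- `v` is a boundary vertex of `G_p`. -/
def IsBoundaryVertex (G : GeomGraph Pt K) (p : P) (v : V p) : Prop :=
  G.vertex p v ∈ frontier (Pt.supp p)

/-- The boundary vertices of `G`. -/
def boundaryVertices (G : GeomGraph Pt K) : Set (P × Plane) :=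
  {a | ∃ v, G.IsBoundaryVertex a.1 v ∧ a.2 = G.vertex a.1 v}

/-- `G` is `T`-consistent: it meets the boundaries of the prototiles only in boundary vertices,
and these form a `T`-consistent set. -/
def IsConsistent (T : Set (P × Plane)) (G : GeomGraph Pt K) : Prop :=
  (∀ p, ∀ z ∈ G.carrier p, z ∈ frontier (Pt.supp p) → ∃ v, z = G.vertex p v) ∧
    IsConsistentSet Pt T G.boundaryVertices

/-- `G` is a quasi-dual graph: `T`-consistent, every `G_p` is a (connected) tree, every edge of a
prototile contains exactly one boundary vertex of `G`, which lies in the interior of that edge,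
and every interior vertex has degree at least `3`. -/
structure IsQuasiDual (T : Set (P × Plane)) (G : GeomGraph Pt K) : Prop where
  consistent : G.IsConsistent T
  tree : ∀ p, (K p).IsTree
  boundary : ∀ p o, IsOpenEdge Pt T p o →
    ∃ v, G.IsBoundaryVertex p v ∧ G.vertex p v ∈ o ∧
      ∀ w, G.IsBoundaryVertex p w → G.vertex p w ∈ closure o → w = v
  degree : ∀ p v, G.vertex p v ∈ interior (Pt.supp p) → 3 ≤ ((K p).neighborSet v).ncard

/-- The point set `Γ(T, G)` obtained by drawing `G` in all the tiles of `T`. This is the boundary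
`∂T⁽⁰⁾` of the tiling `T⁽⁰⁾ = T_G` induced by `G`. -/
def gammaSet (T : Set (P × Plane)) (G : GeomGraph Pt K) : Set Plane :=
  ⋃ t ∈ T, (fun z => z + t.2) '' G.carrier t.1

/-- `(G, S)` is a recurrent pair, with `S ⊆ R^N(G)`. That `G_p` and `S_p` are equivalent is
expressed by their being embeddings of the same graph `K p`; the homeomorphism `ψ̃_p` from `G_p`
onto `S_p` then takes the vertex `v` of `G_p` to the vertex `v` of `S_p`. -/
structure IsRecurrentPair (σ : Substitution Pt) (T : Set (P × Plane)) (N : ℕ)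
    (G S : GeomGraph Pt K) : Prop where
  one_le : 1 ≤ N
  consistent_left : G.IsConsistent T
  consistent_right : S.IsConsistent T
  subset : ∀ p, S.carrier p ⊆ ((contract σ)^[N] G.carrier) p
  boundary_iff : ∀ p v, G.IsBoundaryVertex p v ↔ S.IsBoundaryVertex p v
  same_edge : ∀ p v, G.IsBoundaryVertex p v →
    ∃ o, IsOpenEdge Pt T p o ∧ G.vertex p v ∈ closure o ∧ S.vertex p v ∈ closure o

/-- The homeomorphism `ψ̃_p = ι_S ∘ ι_G⁻¹` from `G_p` onto `S_p`. -/
noncomputable def psiTilde (G S : GeomGraph Pt K) (p : P) (z : Plane) : Plane :=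
  S.ι p (Function.invFunOn (G.ι p) (realization (K p)) z)

/-- `ψ̃` is piecewise constant-speed: every edge of `G` has finite length, and on it `ψ̃`
multiplies the length of all sub-arcs by one constant. -/
def IsConstantSpeed (G S : GeomGraph Pt K) : Prop :=
  ∀ p a b, (K p).Adj a b →
    eVariationOn (G.edgePath p a b) (Icc 0 1) ≠ ⊤ ∧
      ∃ k : NNReal, ∀ s t : ℝ, 0 ≤ s → s ≤ t → t ≤ 1 →
        eVariationOn (S.edgePath p a b) (Icc s t) =
          (k : ENNReal) * eVariationOn (G.edgePath p a b) (Icc s t)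

/-- The injectivity conditions for `N`-subtiles. -/
structure InjectivityConditions (σ : Substitution Pt) (T : Set (P × Plane)) (N : ℕ)
    (S : GeomGraph Pt K) : Prop where
  /-- The patches of two edges have intersecting interiors iff the edges share a vertex. -/
  i1 : ∀ p, ∀ e ∈ (K p).edgeSet, ∀ f ∈ (K p).edgeSet, e ≠ f →
    ((interior (subpatchSupp σ N p (S.edge p e)) ∩
      interior (subpatchSupp σ N p (S.edge p f))).Nonempty ↔ ∃ v, v ∈ e ∧ v ∈ f)
  /-- If two edges share the vertex `v`, then their patches share precisely the patch of `v`,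
  which is a single subtile, contained in the interior of `supp p`. -/
  i2 : ∀ p, ∀ e ∈ (K p).edgeSet, ∀ f ∈ (K p).edgeSet, e ≠ f → ∀ v, v ∈ e → v ∈ f →
    subpatch σ N p (S.edge p e) ∩ subpatch σ N p (S.edge p f) = subpatch σ N p {S.vertex p v} ∧
      ∃ s, subpatch σ N p {S.vertex p v} = {s} ∧ subtileSupp σ N s ⊆ interior (Pt.supp p)
  /-- The patch of `S_p` contains no vertex of `p` in its support. -/
  i3 : ∀ p, subpatchSupp σ N p (S.carrier p) ∩ tileVertices Pt T p = ∅
  /-- The patch of an edge meets the boundary of `p` iff the edge does, and then in a connected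
  set. -/
  i4 : ∀ p, ∀ e ∈ (K p).edgeSet,
    ((subpatchSupp σ N p (S.edge p e) ∩ frontier (Pt.supp p)).Nonempty ↔
        (S.edge p e ∩ frontier (Pt.supp p)).Nonempty) ∧
      ((S.edge p e ∩ frontier (Pt.supp p)).Nonempty →
        IsConnected (subpatchSupp σ N p (S.edge p e) ∩ frontier (Pt.supp p)))

/-! ### The limit map -/

open Classical in
/-- The map `ψ : ∂T⁽⁰⁾ → ℝ²`: if `z` lies in the copy `G_p + x` of `G_p` in the tile `p + x` of
`T`, then `ψ z = ψ̃_p (z - x) + x` (for some choice of the tile, if there are several; the value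
outside `∂T⁽⁰⁾` plays no role). -/
noncomputable def psi (T : Set (P × Plane)) (G S : GeomGraph Pt K) (z : Plane) : Plane :=
  if h : ∃ t ∈ T, z - t.2 ∈ G.carrier t.1 then
    psiTilde G S h.choose.1 (z - h.choose.2) + h.choose.2
  else z

/-- The map `λ^N ψ`. -/
noncomputable def inflatedPsi (σ : Substitution Pt) (T : Set (P × Plane)) (N : ℕ)
    (G S : GeomGraph Pt K) (z : Plane) : Plane :=
  σ.lam ^ N • psi T G S z

/-- The map `ψ⁽ⁿ⁾ = λ^(-Nn) (λ^N ψ)^n`. -/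
noncomputable def psiIter (σ : Substitution Pt) (T : Set (P × Plane)) (N : ℕ)
    (G S : GeomGraph Pt K) (n : ℕ) (z : Plane) : Plane :=
  ((σ.lam ^ N) ^ n)⁻¹ • (inflatedPsi σ T N G S)^[n] z

/-- The pointwise limit `ψ⁽∞⁾` of the maps `ψ⁽ⁿ⁾`. -/
noncomputable def psiLim (σ : Substitution Pt) (T : Set (P × Plane)) (N : ℕ)
    (G S : GeomGraph Pt K) (z : Plane) : Plane :=
  limUnder atTop (fun n => psiIter σ T N G S n z)

end GeomGraph

end FractalTiling

namespace FractalTiling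

section Tiles

variable {P : Type*} {Pt : PrototileSet P} {T : Set (P × Plane)}

theorem IsClosedDisk.isCompact {D : Set Plane} (h : IsClosedDisk D) : IsCompact D := by
  obtain ⟨f, hf, -, rfl, -⟩ := h
  exact (isCompact_closedBall 0 1).image_of_continuousOn hf

theorem IsClosedDisk.interior_nonempty {D : Set Plane} (h : IsClosedDisk D) :
    (interior D).Nonempty := by
  obtain ⟨f, -, -, -, hi⟩ := h
  exact hi ▸ ⟨f 0, mem_image_of_mem f (by simp)⟩

theorem IsClosedDisk.subset_closure_interior {D : Set Plane} (h : IsClosedDisk D) :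
    D ⊆ closure (interior D) := by
  obtain ⟨f, hf, -, rfl, hi⟩ := h
  rw [← hi, ← closure_ball (0 : Plane) one_ne_zero]
  exact ContinuousOn.image_closure (by rwa [closure_ball (0 : Plane) one_ne_zero])

theorem mem_tileSupp {t : P × Plane} {z : Plane} :
    z ∈ tileSupp Pt t ↔ z - t.2 ∈ Pt.supp t.1 := by
  constructor
  · rintro ⟨w, hw, rfl⟩
    simpa using hw
  · exact fun h => ⟨_, h, by simp⟩

theorem tileSupp_eq_homeomorph_image (t : P × Plane) :
    tileSupp Pt t = Homeomorph.addRight t.2 '' Pt.supp t.1 := rfl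

theorem mem_interior_tileSupp {t : P × Plane} {z : Plane} :
    z ∈ interior (tileSupp Pt t) ↔ z - t.2 ∈ interior (Pt.supp t.1) := by
  rw [tileSupp_eq_homeomorph_image, ← Homeomorph.image_interior]
  constructor
  · rintro ⟨w, hw, rfl⟩
    simpa using hw
  · exact fun h => ⟨_, h, by simp⟩

theorem mem_frontier_tileSupp {t : P × Plane} {z : Plane} :
    z ∈ frontier (tileSupp Pt t) ↔ z - t.2 ∈ frontier (Pt.supp t.1) := by
  rw [tileSupp_eq_homeomorph_image, ← Homeomorph.image_frontier]
  constructor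
  · rintro ⟨w, hw, rfl⟩
    simpa using hw
  · exact fun h => ⟨_, h, by simp⟩

theorem isCompact_tileSupp (t : P × Plane) : IsCompact (tileSupp Pt t) :=
  (Pt.isClosedDisk t.1).isCompact.image (by fun_prop)

theorem isClosed_tileSupp (t : P × Plane) : IsClosed (tileSupp Pt t) :=
  (isCompact_tileSupp t).isClosed

theorem frontier_supp_subset (p : P) : frontier (Pt.supp p) ⊆ Pt.supp p :=
  (Pt.isClosedDisk p).isCompact.isClosed.frontier_subset

theorem mem_supp_iff_interior_or_frontier {p : P} {z : Plane} :
    z ∈ Pt.supp p ↔ z ∈ interior (Pt.supp p) ∨ z ∈ frontier (Pt.supp p) := by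
  have h := (Pt.isClosedDisk p).isCompact.isClosed
  rw [h.frontier_eq]
  constructor
  · intro hz
    by_cases hi : z ∈ interior (Pt.supp p)
    · exact Or.inl hi
    · exact Or.inr ⟨hz, hi⟩
  · rintro (hz | hz)
    · exact interior_subset hz
    · exact hz.1

theorem tileSupp_subset_closure_interior (t : P × Plane) :
    tileSupp Pt t ⊆ closure (interior (tileSupp Pt t)) := by
  rw [tileSupp_eq_homeomorph_image, ← Homeomorph.image_interior, ← Homeomorph.image_closure]
  exact image_mono (Pt.isClosedDisk t.1).subset_closure_interior

theorem exists_supp_bound [Finite P] (Pt : PrototileSet P) :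
    ∃ M : ℝ, ∀ p, ∀ z ∈ Pt.supp p, ‖z‖ ≤ M := by
  have h : Bornology.IsBounded (⋃ p, Pt.supp p) :=
    Bornology.isBounded_iUnion.2 fun p => (Pt.isClosedDisk p).isCompact.isBounded
  obtain ⟨M, hM⟩ := h.exists_norm_le
  exact ⟨M, fun p z hz => hM z (mem_iUnion.2 ⟨p, hz⟩)⟩

open MeasureTheory in
theorem IsTiling.finite_meeting [Finite P] (hT : IsTiling Pt T) (c : Plane) (R : ℝ) :
    {t | t ∈ T ∧ (tileSupp Pt t ∩ Metric.closedBall c R).Nonempty}.Finite := by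
  obtain ⟨M, hM⟩ := exists_supp_bound Pt
  have key : ∀ p, {t | t ∈ T ∧ t.1 = p ∧
      (tileSupp Pt t ∩ Metric.closedBall c R).Nonempty}.Finite := by
    intro p
    set I := {t | t ∈ T ∧ t.1 = p ∧ (tileSupp Pt t ∩ Metric.closedBall c R).Nonempty}
    have hvol : ∀ t : I, volume (interior (tileSupp Pt t.1)) = volume (interior (Pt.supp p)) := by
      rintro ⟨t, ht⟩
      rw [← ht.2.1, tileSupp_eq_homeomorph_image, ← Homeomorph.image_interior]
      change volume ((fun z => z + t.2) '' _) = _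
      rw [image_add_right, measure_preimage_add_right]
    have hfin := Measure.finite_const_le_meas_of_disjoint_iUnion (volume : Measure Plane)
      (ε := volume (interior (Pt.supp p)))
      (isOpen_interior.measure_pos _ (Pt.isClosedDisk p).interior_nonempty)
      (As := fun t : I => interior (tileSupp Pt t.1))
      (fun t => isOpen_interior.measurableSet)
      (fun s t hst => disjoint_iff_inter_eq_empty.2
        (hT.packing s.1 s.2.1 t.1 t.2.1 (fun h => hst (Subtype.ext h))))
      (by
        refine ne_top_of_le_ne_top
          (measure_closedBall_lt_top (μ := (volume : Measure Plane)) (x := c) (r := R + 2 * M)).ne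
          (measure_mono (iUnion_subset ?_))
        rintro ⟨t, ht⟩ z hz
        obtain ⟨y, hy, hyR⟩ := ht.2.2
        have h1 := hM _ _ (mem_tileSupp.1 hy)
        have h2 := hM _ _ (mem_tileSupp.1 (interior_subset hz))
        rw [Metric.mem_closedBall, dist_eq_norm] at hyR ⊢
        calc ‖z - c‖ = ‖(z - t.2) - (y - t.2) + (y - c)‖ := by congr 1; abel
          _ ≤ ‖(z - t.2) - (y - t.2)‖ + ‖y - c‖ := norm_add_le _ _
          _ ≤ (‖z - t.2‖ + ‖y - t.2‖) + ‖y - c‖ := by gcongr; exact norm_sub_le _ _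
          _ ≤ R + 2 * M := by linarith)
    have : {t : I | volume (interior (Pt.supp p)) ≤ volume (interior (tileSupp Pt t.1))} = univ :=
      eq_univ_of_forall fun t => (hvol t).ge
    rw [this] at hfin
    have : Finite I := finite_univ_iff.1 hfin
    exact I.toFinite
  refine (finite_iUnion key).subset ?_
  rintro t ⟨ht, hm⟩
  exact mem_iUnion.2 ⟨t.1, ht, rfl, hm⟩

theorem IsTiling.isClosed_biUnion [Finite P] (hT : IsTiling Pt T) {U : Set (P × Plane)}
    (hU : U ⊆ T) : IsClosed (⋃ t ∈ U, tileSupp Pt t) := by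
  rw [biUnion_eq_iUnion]
  refine LocallyFinite.isClosed_iUnion ?_ fun t => isClosed_tileSupp _
  intro z
  refine ⟨Metric.closedBall z 1, Metric.closedBall_mem_nhds z one_pos, ?_⟩
  refine Finite.of_finite_image (f := Subtype.val) ((hT.finite_meeting z 1).subset ?_)
    Subtype.val_injective.injOn
  rintro _ ⟨t, ht, rfl⟩
  exact ⟨hU t.2, ht⟩

theorem IsTiling.exists_mem (hT : IsTiling Pt T) (z : Plane) : ∃ t ∈ T, z ∈ tileSupp Pt t := by
  have : z ∈ ⋃ t ∈ T, tileSupp Pt t := hT.covers ▸ mem_univ z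
  simpa using this

theorem IsTiling.exists_ne_of_mem_frontier [Finite P] (hT : IsTiling Pt T) {t : P × Plane}
    {z : Plane} (hz : z ∈ frontier (tileSupp Pt t)) : ∃ s ∈ T, s ≠ t ∧ z ∈ tileSupp Pt s := by
  have hc := hT.isClosed_biUnion (U := T \ {t}) sdiff_subset
  have hsub : (tileSupp Pt t)ᶜ ⊆ ⋃ s ∈ T \ {t}, tileSupp Pt s := by
    intro y hy
    obtain ⟨s, hs, hys⟩ := hT.exists_mem y
    exact mem_biUnion (show s ∈ T \ {t} from ⟨hs, fun h => hy (h ▸ hys)⟩) hys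
  rw [frontier_eq_closure_inter_closure] at hz
  have := closure_minimal hsub hc hz.2
  obtain ⟨s, hs, hzs⟩ := mem_iUnion₂.1 this
  exact ⟨s, hs.1, hs.2, hzs⟩

theorem eq_of_mem_interior (hT : IsTiling Pt T) {s t : P × Plane} (hs : s ∈ T) (ht : t ∈ T)
    {z : Plane} (hzs : z ∈ interior (tileSupp Pt s)) (hzt : z ∈ tileSupp Pt t) : s = t := by
  by_contra hne
  obtain ⟨y, hy⟩ := mem_closure_iff.1 (tileSupp_subset_closure_interior t hzt) _
    isOpen_interior hzs
  rw [hT.packing s hs t ht hne] at hy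
  exact hy

theorem mem_frontier_of_mem_of_mem (hT : IsTiling Pt T) {s t : P × Plane} (hs : s ∈ T)
    (ht : t ∈ T) (hne : s ≠ t) {z : Plane} (hzs : z ∈ tileSupp Pt s) (hzt : z ∈ tileSupp Pt t) :
    z ∈ frontier (tileSupp Pt s) := by
  rw [(isClosed_tileSupp s).frontier_eq]
  exact ⟨hzs, fun h => hne (eq_of_mem_interior hT hs ht h hzt)⟩

theorem meets_of_mem_of_mem (hT : IsTiling Pt T) {s t : P × Plane} (hs : s ∈ T)
    (ht : t ∈ T) (hne : s ≠ t) {z : Plane} (hzs : z ∈ tileSupp Pt s) (hzt : z ∈ tileSupp Pt t) :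
    Meets Pt T (s.1, z - s.2) (t.1, z - t.2) :=
  ⟨mem_frontier_tileSupp.1 (mem_frontier_of_mem_of_mem hT hs ht hne hzs hzt),
    mem_frontier_tileSupp.1 (mem_frontier_of_mem_of_mem hT ht hs hne.symm hzt hzs),
    s.2, t.2, hs, ht, by simp⟩

theorem mem_tileVertices_of_meets {p q : P} {a b : Plane} (h : Meets Pt T (p, a) (q, b))
    (hb : b ∈ tileVertices Pt T q) : a ∈ tileVertices Pt T p := by
  obtain ⟨c, hc, hcb⟩ := hb
  exact ⟨c, hc, hcb.trans _ _ _ (.symm _ _ (.rel _ _ h))⟩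

theorem IsOpenEdge.subset_diff {p : P} {o : Set Plane} (ho : IsOpenEdge Pt T p o) :
    o ⊆ frontier (Pt.supp p) \ tileVertices Pt T p := by
  obtain ⟨a, -, rfl⟩ := ho
  exact connectedComponentIn_subset _ _

theorem IsOpenEdge.isPreconnected {p : P} {o : Set Plane} (ho : IsOpenEdge Pt T p o) :
    IsPreconnected o := by
  obtain ⟨a, -, rfl⟩ := ho
  exact isPreconnected_connectedComponentIn

theorem IsOpenEdge.subset_of_isPreconnected {p : P} {o A : Set Plane} (ho : IsOpenEdge Pt T p o)
    (hA : IsPreconnected A) (hsub : A ⊆ frontier (Pt.supp p) \ tileVertices Pt T p)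
    (hne : (o ∩ A).Nonempty) : A ⊆ o := by
  obtain ⟨a, ha, rfl⟩ := ho
  obtain ⟨b, hbo, hbA⟩ := hne
  rw [connectedComponentIn_eq hbo]
  exact hA.subset_connectedComponentIn hbA hsub

theorem IsOpenEdge.mem_of_mem_closure {p : P} {o : Set Plane} (ho : IsOpenEdge Pt T p o)
    {z : Plane} (hz : z ∈ closure o) (hv : z ∉ tileVertices Pt T p) : z ∈ o := by
  have hzf : z ∈ frontier (Pt.supp p) :=
    closure_minimal (fun y hy => (ho.subset_diff hy).1) isClosed_frontier hz
  refine ho.subset_of_isPreconnected (A := insert z o) ?_ ?_ ?_ (mem_insert _ _)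
  · exact ho.isPreconnected.subset_closure (subset_insert _ _)
      (insert_subset hz subset_closure)
  · exact insert_subset ⟨hzf, hv⟩ ho.subset_diff
  · obtain ⟨a, ha, rfl⟩ := ho
    have := mem_connectedComponentIn ha
    exact ⟨a, this, mem_insert_of_mem _ this⟩

/-- An open edge of a tile that meets another tile is contained in it. -/
theorem IsOpenEdge.add_mem_tileSupp [Finite P] (hT : IsTiling Pt T) {s t : P × Plane}
    (hs : s ∈ T) (ht : t ∈ T) {o : Set Plane} (ho : IsOpenEdge Pt T s.1 o) {w w' : Plane}
    (hw : w ∈ o) (hwt : w + s.2 ∈ tileSupp Pt t) (hw' : w' ∈ o) : w' + s.2 ∈ tileSupp Pt t := by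
  by_cases hst : s = t
  · subst hst
    exact ⟨w', frontier_supp_subset _ (ho.subset_diff hw').1, rfl⟩
  by_contra hcon
  set U := T \ {s, t}
  have hUc : IsClosed (⋃ r ∈ U, tileSupp Pt r) := hT.isClosed_biUnion sdiff_subset
  have hpre := isPreconnected_closed_iff.1
    (ho.isPreconnected.image (fun z => z + s.2) (by fun_prop)) _ _
    (isClosed_tileSupp (Pt := Pt) t) hUc
  have hother : ∀ v ∈ o, v + s.2 ∈ tileSupp Pt t ∨ v + s.2 ∈ ⋃ r ∈ U, tileSupp Pt r := by
    intro v hv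
    obtain ⟨r, hr, hrs, hvr⟩ := hT.exists_ne_of_mem_frontier (t := s) (z := v + s.2)
      (mem_frontier_tileSupp.2 (by simpa using (ho.subset_diff hv).1))
    by_cases hrt : r = t
    · exact Or.inl (hrt ▸ hvr)
    · exact Or.inr (mem_biUnion (show r ∈ U from ⟨hr, by simp [hrs, hrt]⟩) hvr)
  obtain ⟨_, ⟨v, hv, rfl⟩, hvt, hvU⟩ := hpre
    (by rintro _ ⟨v, hv, rfl⟩; exact hother v hv)
    ⟨_, ⟨w, hw, rfl⟩, hwt⟩
    ⟨_, ⟨w', hw', rfl⟩, (hother w' hw').resolve_left hcon⟩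
  obtain ⟨r, hr, hvr⟩ := mem_iUnion₂.1 hvU
  refine (ho.subset_diff hv).2 ⟨(s.1, v), ⟨(ho.subset_diff hv).1, s.2, hs, ?_⟩, .refl _⟩
  have hsub : ({s, t, r} : Set (P × Plane)) ⊆ {t | t ∈ T ∧ v + s.2 ∈ tileSupp Pt t} := by
    rintro q (rfl | rfl | rfl)
    · exact ⟨hs, ⟨v, frontier_supp_subset _ (ho.subset_diff hv).1, rfl⟩⟩
    · exact ⟨ht, hvt⟩
    · exact ⟨hr.1, hvr⟩
  refine le_trans (le_of_eq ?_) (encard_le_encard hsub)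
  have hr' : r ≠ s ∧ r ≠ t := by simpa using hr.2
  exact (encard_eq_three.2 ⟨s, t, r, hst, hr'.1.symm, hr'.2.symm, rfl⟩).symm

/-- The part of an open edge of a tile in another tile of the tiling lies on the boundary of that
tile and contains none of its vertices. -/
theorem IsOpenEdge.sub_mem_diff (hT : IsTiling Pt T) {s t : P × Plane} (hs : s ∈ T) (ht : t ∈ T)
    {o : Set Plane} (ho : IsOpenEdge Pt T s.1 o) {w : Plane} (hw : w ∈ o)
    (hwt : w + s.2 ∈ tileSupp Pt t) :
    w + s.2 - t.2 ∈ frontier (Pt.supp t.1) \ tileVertices Pt T t.1 := by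
  by_cases hst : s = t
  · subst hst
    simpa using ho.subset_diff hw
  have hm := meets_of_mem_of_mem hT hs ht hst
    (mem_tileSupp.2 (by simpa using frontier_supp_subset _ (ho.subset_diff hw).1)) hwt
  refine ⟨hm.2.1, fun hv => (ho.subset_diff hw).2 ?_⟩
  have := mem_tileVertices_of_meets hm hv
  simpa using this

end Tiles

end FractalTiling

namespace FractalTiling

section Subtiles

variable {P : Type*} {Pt : PrototileSet P} {T : Set (P × Plane)} {σ : Substitution Pt}

theorem Substitution.lam_pos (σ : Substitution Pt) : 0 < σ.lam :=
  zero_lt_one.trans σ.one_lt_lam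

theorem Substitution.lam_ne_zero (σ : Substitution Pt) : σ.lam ≠ 0 := σ.lam_pos.ne'

theorem Substitution.lam_pow_ne_zero (σ : Substitution Pt) (n : ℕ) : σ.lam ^ n ≠ 0 :=
  pow_ne_zero n σ.lam_ne_zero

/-- The tile of `λ^N t` that is the inflation of the `N`-subtile `s` of the tile `t`. -/
def inflatedSubtile (σ : Substitution Pt) (N : ℕ) (t s : P × Plane) : P × Plane :=
  (s.1, σ.lam ^ N • (s.2 + t.2))

theorem inflatedSubtile_mem (hσ : IsSelfSimilar σ T) {N : ℕ} {t s : P × Plane} (ht : t ∈ T)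
    (hs : s ∈ subtiles σ N t.1) : inflatedSubtile σ N t s ∈ T := by
  induction N generalizing t s with
  | zero =>
    obtain ⟨p, x⟩ := t
    obtain rfl : s = (p, 0) := hs
    simpa [inflatedSubtile] using ht
  | succ n ih =>
    obtain ⟨d, hd, u, hu, rfl⟩ := hs
    have hmem : (d.1, d.2 + σ.lam • t.2) ∈ translate (σ.omega t.1 : Set (P × Plane))
        (σ.lam • t.2) := ⟨d, hd, rfl⟩
    rw [← hσ.enclosed t ht] at hmem
    have := ih hmem.1 hu
    have he : inflatedSubtile σ (n + 1) t (u.1, σ.lam⁻¹ • (u.2 + d.2)) =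
        inflatedSubtile σ n (d.1, d.2 + σ.lam • t.2) u := by
      simp only [inflatedSubtile, Prod.mk.injEq, true_and]
      rw [pow_succ, mul_smul, smul_add σ.lam, smul_inv_smul₀ σ.lam_ne_zero, add_assoc]
    rwa [he]

theorem mem_tileSupp_inflatedSubtile {N : ℕ} {t s : P × Plane} {z : Plane} :
    σ.lam ^ N • (z + t.2) ∈ tileSupp Pt (inflatedSubtile σ N t s) ↔ z ∈ subtileSupp σ N s := by
  rw [mem_tileSupp]
  have h0 := σ.lam_pow_ne_zero N
  have he : σ.lam ^ N • (z + t.2) - (inflatedSubtile σ N t s).2 = σ.lam ^ N • (z - s.2) := by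
    simp only [inflatedSubtile]
    rw [← smul_sub]
    congr 1
    abel
  rw [he]
  constructor
  · intro h
    exact ⟨_, h, by simp [h0]⟩
  · rintro ⟨w, hw, rfl⟩
    simpa [inflatedSubtile, h0] using hw

theorem subtileSupp_subset {N : ℕ} {p : P} {s : P × Plane} (hs : s ∈ subtiles σ N p) :
    subtileSupp σ N s ⊆ Pt.supp p := by
  induction N generalizing p s with
  | zero =>
    obtain rfl : s = (p, 0) := hs
    rintro _ ⟨z, hz, rfl⟩
    simpa using hz
  | succ n ih =>
    obtain ⟨d, hd, u, hu, rfl⟩ := hs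
    rintro _ ⟨z, hz, rfl⟩
    have h1 : (σ.lam ^ n)⁻¹ • z + u.2 ∈ Pt.supp d.1 := ih hu ⟨z, hz, rfl⟩
    have h2 : (σ.lam ^ n)⁻¹ • z + u.2 + d.2 ∈ ⋃ t ∈ σ.omega p, tileSupp Pt t :=
      mem_biUnion hd ⟨_, h1, rfl⟩
    rw [σ.supp_omega] at h2
    obtain ⟨y, hy, hyz⟩ := h2
    convert hy using 1
    apply smul_right_injective _ σ.lam_ne_zero
    simp only at hyz ⊢
    rw [hyz, smul_add, smul_inv_smul₀ σ.lam_ne_zero, pow_succ, mul_inv, mul_comm, mul_smul,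
      smul_inv_smul₀ σ.lam_ne_zero, add_assoc]

theorem exists_subtile {N : ℕ} {p : P} {z : Plane} (hz : z ∈ Pt.supp p) :
    ∃ s ∈ subtiles σ N p, z ∈ subtileSupp σ N s := by
  induction N generalizing p z with
  | zero => exact ⟨(p, 0), rfl, z, hz, by simp⟩
  | succ n ih =>
    have h2 : σ.lam • z ∈ ⋃ t ∈ σ.omega p, tileSupp Pt t := by
      rw [σ.supp_omega]
      exact ⟨z, hz, rfl⟩
    obtain ⟨d, hd, y, hy, hyz⟩ := mem_iUnion₂.1 h2
    obtain ⟨u, hu, w, hw, hwy⟩ := ih hy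
    refine ⟨_, ⟨d, hd, u, hu, rfl⟩, w, hw, ?_⟩
    apply smul_right_injective _ σ.lam_ne_zero
    simp only at hyz hwy ⊢
    rw [← hyz, smul_add, smul_inv_smul₀ σ.lam_ne_zero, pow_succ, mul_inv, mul_comm, mul_smul,
      smul_inv_smul₀ σ.lam_ne_zero, ← hwy, add_assoc]

theorem exists_of_mem_iterate_contract {N : ℕ} {B : P → Set Plane} {p : P} {z : Plane}
    (hz : z ∈ ((contract σ)^[N] B) p) :
    ∃ s ∈ subtiles σ N p, ∃ b ∈ B s.1, z = (σ.lam ^ N)⁻¹ • b + s.2 := by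
  induction N generalizing p z with
  | zero => exact ⟨(p, 0), rfl, z, hz, by simp⟩
  | succ n ih =>
    rw [Function.iterate_succ_apply'] at hz
    obtain ⟨d, hd, y, hy, rfl⟩ := mem_iUnion₂.1 hz
    obtain ⟨u, hu, b, hb, rfl⟩ := ih hy
    refine ⟨_, ⟨d, hd, u, hu, rfl⟩, b, hb, ?_⟩
    simp only
    rw [pow_succ, mul_inv, mul_comm, mul_smul, ← smul_add, add_assoc]

theorem subtileSupp_eq_homeomorph_image (N : ℕ) (s : P × Plane) :
    subtileSupp σ N s = ((Homeomorph.smulOfNeZero (σ.lam ^ N)⁻¹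
      (inv_ne_zero (σ.lam_pow_ne_zero N))).trans (Homeomorph.addRight s.2)) '' Pt.supp s.1 := rfl

theorem interior_subtileSupp_nonempty (N : ℕ) (s : P × Plane) :
    (interior (subtileSupp σ N s)).Nonempty := by
  rw [subtileSupp_eq_homeomorph_image, ← Homeomorph.image_interior]
  exact (Pt.isClosedDisk s.1).interior_nonempty.image _

theorem interior_subpatchSupp_inter_nonempty {N : ℕ} {p : P} {A B : Set Plane} {s : P × Plane}
    (hA : s ∈ subpatch σ N p A) (hB : s ∈ subpatch σ N p B) :
    (interior (subpatchSupp σ N p A) ∩ interior (subpatchSupp σ N p B)).Nonempty := by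
  obtain ⟨z, hz⟩ := interior_subtileSupp_nonempty (σ := σ) N s
  exact ⟨z, interior_mono (subset_biUnion_of_mem (u := fun s => subtileSupp σ N s) hA) hz,
    interior_mono (subset_biUnion_of_mem (u := fun s => subtileSupp σ N s) hB) hz⟩

theorem mem_subpatch {N : ℕ} {p : P} {B : Set Plane} {s : P × Plane} {z : Plane}
    (hs : s ∈ subtiles σ N p) (hz : z ∈ subtileSupp σ N s) (hB : z ∈ B) :
    s ∈ subpatch σ N p B := ⟨hs, z, hz, hB⟩

theorem mem_subpatchSupp {N : ℕ} {p : P} {B : Set Plane} {s : P × Plane} {z y : Plane}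
    (hs : s ∈ subtiles σ N p) (hz : z ∈ subtileSupp σ N s) (hB : z ∈ B)
    (hy : y ∈ subtileSupp σ N s) : y ∈ subpatchSupp σ N p B :=
  mem_biUnion (mem_subpatch hs hz hB) hy

end Subtiles

/-! ### The realization of a graph -/

section Realization

variable {V : Type*}

theorem vertexCoord_apply [DecidableEq V] (v c : V) :
    vertexCoord v c = if c = v then (1 : ℝ) else 0 := by
  by_cases h : c = v
  · subst h
    simp [vertexCoord]
  · simp [vertexCoord, h]

theorem vertexCoord_ne_zero_iff {v c : V} : vertexCoord v c ≠ 0 ↔ c = v := by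
  classical
  rw [vertexCoord_apply]
  split_ifs with h <;> simp [h]

/-- The parametrization of the segment `cell s(a, b)`. -/
noncomputable def cellPath (a b : V) (s : ℝ) : V → ℝ :=
  (1 - s) • vertexCoord a + s • vertexCoord b

theorem continuous_cellPath (a b : V) : Continuous (cellPath a b) := by
  unfold cellPath
  fun_prop

@[simp] theorem cellPath_zero (a b : V) : cellPath a b 0 = vertexCoord a := by simp [cellPath]

@[simp] theorem cellPath_one (a b : V) : cellPath a b 1 = vertexCoord b := by simp [cellPath]

theorem cellPath_apply_left {a b : V} (hab : a ≠ b) (s : ℝ) : cellPath a b s a = 1 - s := by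
  classical
  simp [cellPath, vertexCoord_apply, hab]

theorem cellPath_apply_right {a b : V} (hab : a ≠ b) (s : ℝ) : cellPath a b s b = s := by
  classical
  simp [cellPath, vertexCoord_apply, hab.symm]

theorem cellPath_injective {a b : V} (hab : a ≠ b) : Function.Injective (cellPath a b) := by
  intro s t h
  rw [← cellPath_apply_right hab s, h, cellPath_apply_right hab t]

theorem cellPath_ne_vertexCoord {a b : V} (hab : a ≠ b) {s : ℝ} (hs : s ∈ Ioo (0 : ℝ) 1) (v : V) :
    cellPath a b s ≠ vertexCoord v := by
  intro h
  have ha := vertexCoord_ne_zero_iff.1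
    (h ▸ (by rw [cellPath_apply_left hab]; linarith [hs.2] : cellPath a b s a ≠ 0))
  have hb := vertexCoord_ne_zero_iff.1
    (h ▸ (by rw [cellPath_apply_right hab]; linarith [hs.1] : cellPath a b s b ≠ 0))
  exact hab (ha.trans hb.symm)

variable [Fintype V] {K : SimpleGraph V}

theorem vertexCoord_mem_stdSimplex (v : V) : vertexCoord v ∈ stdSimplex ℝ V := by
  classical
  have := single_mem_stdSimplex ℝ v
  unfold vertexCoord
  convert this

theorem vertexCoord_mem_cell_iff {v : V} {e : Sym2 V} : vertexCoord v ∈ cell e ↔ v ∈ e := by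
  constructor
  · exact fun h => h.2 v (vertexCoord_ne_zero_iff.2 rfl)
  · intro h
    refine ⟨vertexCoord_mem_stdSimplex v, fun c hc => ?_⟩
    rwa [vertexCoord_ne_zero_iff.1 hc]

theorem cell_subset_realization {e : Sym2 V} (he : e ∈ K.edgeSet) : cell e ⊆ realization K :=
  subset_biUnion_of_mem (u := fun e => cell e) he

theorem mem_realization {w : V → ℝ} : w ∈ realization K ↔ ∃ e ∈ K.edgeSet, w ∈ cell e := by
  simp [realization]

theorem cellPath_mem {a b : V} {s : ℝ} (hs : s ∈ Icc (0 : ℝ) 1) :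
    cellPath a b s ∈ cell s(a, b) := by
  classical
  refine ⟨(convex_stdSimplex ℝ V) (vertexCoord_mem_stdSimplex a) (vertexCoord_mem_stdSimplex b)
    (by linarith [hs.2]) hs.1 (by ring), fun c hc => ?_⟩
  by_contra hcon
  rw [Sym2.mem_iff, not_or] at hcon
  simp [cellPath, vertexCoord_apply, hcon.1, hcon.2] at hc

theorem cell_eq_image {a b : V} (hab : a ≠ b) :
    cell s(a, b) = cellPath a b '' Icc (0 : ℝ) 1 := by
  classical
  refine Subset.antisymm ?_ ?_
  · rintro w ⟨⟨hw0, hw1⟩, hw⟩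
    have hz : ∀ c, c ≠ a → c ≠ b → w c = 0 := by
      intro c hca hcb
      by_contra hc
      simpa [hca, hcb] using hw c hc
    have hsum : w a + w b = 1 := by
      rw [← hw1, ← Finset.sum_subset (Finset.subset_univ {a, b}), Finset.sum_pair hab]
      intro c _ hc
      simp only [Finset.mem_insert, Finset.mem_singleton, not_or] at hc
      exact hz c hc.1 hc.2
    refine ⟨w b, ⟨hw0 b, by linarith [hw0 a]⟩, ?_⟩
    funext c
    by_cases hca : c = a
    · rw [hca, cellPath_apply_left hab]
      linarith
    by_cases hcb : c = b
    · rw [hcb, cellPath_apply_right hab]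
    · simp [cellPath, vertexCoord_apply, hca, hcb, hz c hca hcb]
  · rintro _ ⟨s, hs, rfl⟩
    exact cellPath_mem hs

theorem cellPath_mem_cell_iff {a b : V} (hab : a ≠ b) {s : ℝ} (hs : s ∈ Ioo (0 : ℝ) 1)
    {e : Sym2 V} : cellPath a b s ∈ cell e ↔ e = s(a, b) := by
  constructor
  · intro h
    have ha := h.2 a (by rw [cellPath_apply_left hab]; linarith [hs.2])
    have hb := h.2 b (by rw [cellPath_apply_right hab]; linarith [hs.1])
    exact (Sym2.mem_and_mem_iff hab).1 ⟨ha, hb⟩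
  · rintro rfl
    exact cellPath_mem (Ioo_subset_Icc_self hs)

/-- Two edges meet at most in a common vertex. -/
theorem exists_eq_vertexCoord_of_mem_cell {e f : Sym2 V} (hne : e ≠ f)
    {w : V → ℝ} (hwe : w ∈ cell e) (hwf : w ∈ cell f) :
    ∃ v, v ∈ e ∧ v ∈ f ∧ w = vertexCoord v := by
  classical
  obtain ⟨v, hv⟩ : ∃ v, w v ≠ 0 := by
    by_contra! h
    simpa [h] using hwe.1.2
  refine ⟨v, hwe.2 v hv, hwf.2 v hv, ?_⟩
  have hz : ∀ c, c ≠ v → w c = 0 := by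
    intro c hc
    by_contra h
    exact hne (((Sym2.mem_and_mem_iff hc).1 ⟨hwe.2 c h, hwe.2 v hv⟩).trans
      ((Sym2.mem_and_mem_iff hc).1 ⟨hwf.2 c h, hwf.2 v hv⟩).symm)
  have h1 := hwe.1.2
  rw [Finset.sum_eq_single v (fun c _ hc => hz c hc) (by simp)] at h1
  funext c
  by_cases hc : c = v
  · rw [vertexCoord_apply, if_pos hc, hc, h1]
  · rw [vertexCoord_apply, if_neg hc, hz c hc]

theorem isCompact_cell (e : Sym2 V) : IsCompact (cell e) := by
  classical
  have : cell e = stdSimplex ℝ V ∩ ⋂ c, {w : V → ℝ | w c ≠ 0 → c ∈ e} := by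
    ext w
    simp [cell]
  rw [this]
  refine (isCompact_stdSimplex ℝ V).inter_right (isClosed_iInter fun c => ?_)
  by_cases hc : c ∈ e
  · simp [hc]
  · simp only [hc, imp_false, not_not]
    exact isClosed_eq (continuous_apply c) continuous_const

end Realization

end FractalTiling

namespace FractalTiling

namespace GeomGraph

variable {P : Type*} {Pt : PrototileSet P} {T : Set (P × Plane)} {σ : Substitution Pt}
  {V : P → Type*} [∀ p, Fintype (V p)] {K : ∀ p, SimpleGraph (V p)} {N : ℕ} {G S : GeomGraph Pt K}

/-! ### Vertices of geometric graphs -/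

theorem exists_adj (G : GeomGraph Pt K) (p : P) (v : V p) : ∃ w, (K p).Adj v w := by
  by_contra! h
  refine G.degree_ne_zero p v ?_
  rw [(ncard_eq_zero (toFinite _))]
  exact eq_empty_of_forall_notMem h

theorem vertexCoord_mem_realization (G : GeomGraph Pt K) (p : P) (v : V p) :
    vertexCoord v ∈ realization (K p) := by
  obtain ⟨w, hw⟩ := G.exists_adj p v
  exact mem_realization.2 ⟨s(v, w), hw, vertexCoord_mem_cell_iff.2 (Sym2.mem_mk_left v w)⟩

theorem vertex_mem_carrier (G : GeomGraph Pt K) (p : P) (v : V p) :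
    G.vertex p v ∈ G.carrier p := ⟨_, G.vertexCoord_mem_realization p v, rfl⟩

theorem carrier_subset (G : GeomGraph Pt K) (p : P) : G.carrier p ⊆ Pt.supp p :=
  (G.mapsTo p).image_subset

theorem vertex_mem_edge_iff (G : GeomGraph Pt K) {p : P} {v : V p} {e : Sym2 (V p)}
    (he : e ∈ (K p).edgeSet) : G.vertex p v ∈ G.edge p e ↔ v ∈ e := by
  rw [← vertexCoord_mem_cell_iff]
  constructor
  · rintro ⟨w, hw, hwv⟩
    rwa [← G.injOn p (cell_subset_realization he hw) (G.vertexCoord_mem_realization p v) hwv]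
  · exact fun h => ⟨_, h, rfl⟩

theorem IsConsistent.exists_vertexCoord (hG : G.IsConsistent T) {p : P} {w : V p → ℝ}
    (hw : w ∈ realization (K p)) (hf : G.ι p w ∈ frontier (Pt.supp p)) :
    ∃ v, w = vertexCoord v ∧ G.IsBoundaryVertex p v := by
  obtain ⟨v, hv⟩ := hG.1 p _ ⟨w, hw, rfl⟩ hf
  exact ⟨v, G.injOn p hw (G.vertexCoord_mem_realization p v) hv, by
    unfold IsBoundaryVertex
    rwa [← hv]⟩

theorem IsConsistent.exists_vertex_of_meets (hG : G.IsConsistent T) {p q : P} {v : V p}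
    (hv : G.IsBoundaryVertex p v) {b : Plane} (h : Meets Pt T (p, G.vertex p v) (q, b)) :
    ∃ w, G.IsBoundaryVertex q w ∧ b = G.vertex q w :=
  hG.2.2 (p, G.vertex p v) ⟨v, hv, rfl⟩ (q, b) (.rel _ _ h)

theorem mem_gammaSet {z : Plane} :
    z ∈ G.gammaSet T ↔ ∃ t ∈ T, ∃ w ∈ realization (K t.1), z = G.ι t.1 w + t.2 := by
  constructor
  · intro h
    obtain ⟨t, ht, _, ⟨w, hw, rfl⟩, rfl⟩ := mem_iUnion₂.1 h
    exact ⟨t, ht, w, hw, rfl⟩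
  · rintro ⟨t, ht, w, hw, rfl⟩
    exact mem_biUnion ht ⟨_, ⟨w, hw, rfl⟩, rfl⟩

theorem add_mem_tileSupp (G : GeomGraph Pt K) {t : P × Plane} {w : V t.1 → ℝ}
    (hw : w ∈ realization (K t.1)) : G.ι t.1 w + t.2 ∈ tileSupp Pt t :=
  ⟨_, G.mapsTo _ hw, rfl⟩

theorem IsConsistent.exists_eq_add (hT : IsTiling Pt T) (hG : G.IsConsistent T) {t : P × Plane}
    (ht : t ∈ T) {z : Plane} (hz : z ∈ G.gammaSet T) (hzt : z ∈ tileSupp Pt t) :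
    ∃ w ∈ realization (K t.1), z = G.ι t.1 w + t.2 := by
  obtain ⟨s, hs, w, hw, rfl⟩ := mem_gammaSet.1 hz
  by_cases hst : s = t
  · subst hst
    exact ⟨w, hw, rfl⟩
  have hm := meets_of_mem_of_mem hT hs ht hst (G.add_mem_tileSupp hw) hzt
  rw [add_sub_cancel_right] at hm
  obtain ⟨v, rfl, hv⟩ := hG.exists_vertexCoord hw hm.1
  obtain ⟨u, -, hu⟩ := hG.exists_vertex_of_meets hv hm
  exact ⟨_, G.vertexCoord_mem_realization t.1 u, sub_eq_iff_eq_add.1 hu⟩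

/-! ### Systems satisfying the hypotheses -/

/-- A recurrent pair for a self-similar tiling that satisfies the injectivity conditions, with a
quasi-dual graph and a homeomorphism of piecewise constant speed. -/
structure IsInjectivePair (σ : Substitution Pt) (T : Set (P × Plane)) (N : ℕ)
    (G S : GeomGraph Pt K) : Prop where
  tiling : IsTiling Pt T
  selfSimilar : IsSelfSimilar σ T
  recurrent : IsRecurrentPair σ T N G S
  quasiDual : G.IsQuasiDual T
  constantSpeed : IsConstantSpeed G S
  injectivity : InjectivityConditions σ T N S

theorem psiTilde_ι {p : P} {w : V p → ℝ} (hw : w ∈ realization (K p)) :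
    psiTilde G S p (G.ι p w) = S.ι p w := by
  unfold psiTilde
  rw [(G.injOn p).leftInvOn_invFunOn hw]

theorem psiIter_succ (n : ℕ) (z : Plane) :
    psiIter σ T N G S (n + 1) z =
      (σ.lam ^ N)⁻¹ • psiIter σ T N G S n (inflatedPsi σ T N G S z) := by
  rw [psiIter, psiIter, Function.iterate_succ_apply, pow_succ, mul_inv, mul_comm, mul_smul]

namespace IsInjectivePair

theorem notMem_tileVertices (h : IsInjectivePair σ T N G S) {p : P} {s : P × Plane}
    (hs : s ∈ subtiles σ N p) {w : V p → ℝ} (hw : w ∈ realization (K p))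
    (hws : S.ι p w ∈ subtileSupp σ N s) {y : Plane} (hy : y ∈ subtileSupp σ N s) :
    y ∉ tileVertices Pt T p := by
  intro hv
  have : y ∈ subpatchSupp σ N p (S.carrier p) ∩ tileVertices Pt T p :=
    ⟨mem_subpatchSupp hs hws ⟨w, hw, rfl⟩ hy, hv⟩
  rw [h.injectivity.i3] at this
  exact this

theorem exists_openEdge (h : IsInjectivePair σ T N G S) {p : P} {v : V p}
    (hv : G.IsBoundaryVertex p v) :
    ∃ o, IsOpenEdge Pt T p o ∧ G.vertex p v ∈ o ∧ S.vertex p v ∈ o ∧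
      ∀ w, G.IsBoundaryVertex p w → G.vertex p w ∈ o → w = v := by
  obtain ⟨o, ho, hG, hS⟩ := h.recurrent.same_edge p v hv
  obtain ⟨u, -, huo, hu⟩ := h.quasiDual.boundary p o ho
  obtain rfl := hu v hv hG
  refine ⟨o, ho, huo, ho.mem_of_mem_closure hS ?_, fun w hw hwo => hu w hw (subset_closure hwo)⟩
  obtain ⟨s, hs, hvs⟩ := exists_subtile (σ := σ) (N := N)
    (S.carrier_subset p (S.vertex_mem_carrier p v))
  exact h.notMem_tileVertices hs (S.vertexCoord_mem_realization p v) hvs hvs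

variable [Finite P]

theorem ι_add_eq (h : IsInjectivePair σ T N G S) {s t : P × Plane} (hs : s ∈ T) (ht : t ∈ T)
    {w : V s.1 → ℝ} {u : V t.1 → ℝ} (hw : w ∈ realization (K s.1)) (hu : u ∈ realization (K t.1))
    (heq : G.ι s.1 w + s.2 = G.ι t.1 u + t.2) : S.ι s.1 w + s.2 = S.ι t.1 u + t.2 := by
  by_cases hst : s = t
  · subst hst
    rw [G.injOn _ hw hu (add_right_cancel heq)]
  have hz : G.ι s.1 w + s.2 ∈ tileSupp Pt t := heq ▸ G.add_mem_tileSupp hu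
  have hm := meets_of_mem_of_mem h.tiling hs ht hst (G.add_mem_tileSupp hw) hz
  have hm2 : G.ι s.1 w + s.2 - t.2 = G.ι t.1 u := by rw [heq, add_sub_cancel_right]
  rw [add_sub_cancel_right, hm2] at hm
  have hG := h.recurrent.consistent_left
  obtain ⟨v, rfl, hv⟩ := hG.exists_vertexCoord hw hm.1
  obtain ⟨v', rfl, hv'⟩ := hG.exists_vertexCoord hu hm.2.1
  obtain ⟨o, ho, hGo, hSo, -⟩ := h.exists_openEdge hv
  have hsub : ∀ y ∈ o, y + s.2 ∈ tileSupp Pt t := fun y hy =>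
    ho.add_mem_tileSupp h.tiling hs ht hGo hz hy
  have hSs : S.vertex s.1 v + s.2 ∈ tileSupp Pt s :=
    S.add_mem_tileSupp (S.vertexCoord_mem_realization _ v)
  have hmS := meets_of_mem_of_mem h.tiling hs ht hst hSs (hsub _ hSo)
  rw [add_sub_cancel_right] at hmS
  obtain ⟨v'', hv'', hveq⟩ := h.recurrent.consistent_right.exists_vertex_of_meets
    ((h.recurrent.boundary_iff _ _).1 hv) hmS
  obtain ⟨o', ho', -, hSo', huniq⟩ := h.exists_openEdge ((h.recurrent.boundary_iff _ _).2 hv'')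
  have hsub' := ho'.subset_of_isPreconnected
    (ho.isPreconnected.image (fun y => y + s.2 - t.2) (by fun_prop))
    (by
      rintro _ ⟨y, hy, rfl⟩
      exact ho.sub_mem_diff h.tiling hs ht hy (hsub y hy))
    ⟨_, hSo', _, hSo, hveq⟩
  have hv'v'' : v' = v'' := huniq v' hv' (hsub' ⟨_, hGo, hm2⟩)
  subst hv'v''
  exact sub_eq_iff_eq_add.1 hveq

theorem psi_eq (h : IsInjectivePair σ T N G S) {t : P × Plane} (ht : t ∈ T)
    {w : V t.1 → ℝ} (hw : w ∈ realization (K t.1)) :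
    psi T G S (G.ι t.1 w + t.2) = S.ι t.1 w + t.2 := by
  have hex : ∃ s ∈ T, G.ι t.1 w + t.2 - s.2 ∈ G.carrier s.1 :=
    ⟨t, ht, w, hw, by simp⟩
  unfold psi
  rw [dif_pos hex]
  obtain ⟨hs, u, hu, hus⟩ := hex.choose_spec
  rw [← hus, psiTilde_ι hu]
  exact h.ι_add_eq hs ht hu hw (eq_sub_iff_add_eq.1 hus)

theorem inflatedPsi_eq (h : IsInjectivePair σ T N G S) {t : P × Plane} (ht : t ∈ T)
    {w : V t.1 → ℝ} (hw : w ∈ realization (K t.1)) :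
    inflatedPsi σ T N G S (G.ι t.1 w + t.2) = σ.lam ^ N • (S.ι t.1 w + t.2) := by
  rw [inflatedPsi, h.psi_eq ht hw]

theorem inflatedPsi_mem_tileSupp_iff (h : IsInjectivePair σ T N G S) {t : P × Plane} (ht : t ∈ T)
    {w : V t.1 → ℝ} (hw : w ∈ realization (K t.1)) {s : P × Plane} :
    inflatedPsi σ T N G S (G.ι t.1 w + t.2) ∈ tileSupp Pt (inflatedSubtile σ N t s) ↔
      S.ι t.1 w ∈ subtileSupp σ N s := by
  rw [h.inflatedPsi_eq ht hw, mem_tileSupp_inflatedSubtile]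

theorem mapsTo (h : IsInjectivePair σ T N G S) :
    MapsTo (inflatedPsi σ T N G S) (G.gammaSet T) (G.gammaSet T) := by
  intro z hz
  obtain ⟨t, ht, w, hw, rfl⟩ := mem_gammaSet.1 hz
  obtain ⟨s, hs, _, ⟨u, hu, rfl⟩, heq⟩ :=
    exists_of_mem_iterate_contract (h.recurrent.subset t.1 ⟨w, hw, rfl⟩)
  refine mem_gammaSet.2 ⟨_, inflatedSubtile_mem h.selfSimilar ht hs, u, hu, ?_⟩
  rw [h.inflatedPsi_eq ht hw, heq, add_assoc, smul_add, smul_inv_smul₀ (σ.lam_pow_ne_zero N)]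
  rfl

/-- A point of the inflated image of a tile lies in some inflated subtile. -/
theorem exists_inflatedSubtile (h : IsInjectivePair σ T N G S) {t : P × Plane} (ht : t ∈ T)
    {z : Plane} (hz : z ∈ G.gammaSet T) (hzt : z ∈ tileSupp Pt t) :
    ∃ s ∈ subtiles σ N t.1,
      inflatedPsi σ T N G S z ∈ tileSupp Pt (inflatedSubtile σ N t s) := by
  obtain ⟨w, hw, rfl⟩ := h.recurrent.consistent_left.exists_eq_add h.tiling ht hz hzt
  obtain ⟨s, hs, hws⟩ := exists_subtile (σ := σ) (N := N) (S.mapsTo _ hw)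
  exact ⟨s, hs, (h.inflatedPsi_mem_tileSupp_iff ht hw).2 hws⟩

theorem inflatedPsi_injOn (h : IsInjectivePair σ T N G S) {t : P × Plane} (ht : t ∈ T) :
    InjOn (inflatedPsi σ T N G S) (G.gammaSet T ∩ tileSupp Pt t) := by
  rintro z ⟨hz, hzt⟩ z' ⟨hz', hzt'⟩ heq
  obtain ⟨w, hw, rfl⟩ := h.recurrent.consistent_left.exists_eq_add h.tiling ht hz hzt
  obtain ⟨w', hw', rfl⟩ := h.recurrent.consistent_left.exists_eq_add h.tiling ht hz' hzt'
  rw [h.inflatedPsi_eq ht hw, h.inflatedPsi_eq ht hw'] at heq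
  rw [S.injOn _ hw hw' (add_right_cancel (smul_right_injective _ (σ.lam_pow_ne_zero N) heq))]

/-! ### The limit map -/

theorem tendsto_psiLim (h : IsInjectivePair σ T N G S) {z : Plane} (hz : z ∈ G.gammaSet T) :
    Tendsto (fun n => psiIter σ T N G S n z) atTop (𝓝 (psiLim σ T N G S z)) := by
  obtain ⟨M, hM⟩ := exists_supp_bound Pt
  have hdist : ∀ y ∈ G.gammaSet T, dist y (psi T G S y) ≤ 2 * M := by
    intro y hy
    obtain ⟨t, ht, w, hw, rfl⟩ := mem_gammaSet.1 hy
    rw [h.psi_eq ht hw, dist_add_right, dist_eq_norm]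
    have h1 := hM _ _ (G.mapsTo _ hw)
    have h2 := hM _ _ (S.mapsTo _ hw)
    linarith [norm_sub_le (G.ι t.1 w) (S.ι t.1 w)]
  refine tendsto_nhds_limUnder (cauchySeq_tendsto_of_complete ?_)
  have hlam : 1 < σ.lam ^ N := one_lt_pow₀ σ.one_lt_lam (by have := h.recurrent.one_le; omega)
  refine cauchySeq_of_le_geometric (σ.lam ^ N)⁻¹ (2 * M) (inv_lt_one_of_one_lt₀ hlam)
    fun n => ?_
  have hpos : 0 < σ.lam ^ N := zero_lt_one.trans hlam
  have hiter : psiIter σ T N G S (n + 1) z =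
      ((σ.lam ^ N) ^ n)⁻¹ • psi T G S ((inflatedPsi σ T N G S)^[n] z) := by
    rw [psiIter, Function.iterate_succ_apply', inflatedPsi, pow_succ, mul_inv, mul_smul,
      inv_smul_smul₀ hpos.ne']
  rw [hiter, psiIter, dist_smul₀, Real.norm_of_nonneg (by positivity), inv_pow, mul_comm]
  exact mul_le_mul_of_nonneg_right (hdist _ (h.mapsTo.iterate n hz)) (by positivity)

theorem psiLim_inflatedPsi (h : IsInjectivePair σ T N G S) {z : Plane} (hz : z ∈ G.gammaSet T) :
    psiLim σ T N G S (inflatedPsi σ T N G S z) = σ.lam ^ N • psiLim σ T N G S z := by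
  have h1 := (h.tendsto_psiLim (h.mapsTo hz)).const_smul (σ.lam ^ N)⁻¹
  have h2 := (tendsto_add_atTop_iff_nat 1).2 (h.tendsto_psiLim hz)
  simp only [psiIter_succ] at h2
  rw [← tendsto_nhds_unique h1 h2, smul_inv_smul₀ (σ.lam_pow_ne_zero N)]

theorem psiIter_mem_tileSupp (h : IsInjectivePair σ T N G S) (n : ℕ) {t : P × Plane} (ht : t ∈ T)
    {z : Plane} (hz : z ∈ G.gammaSet T) (hzt : z ∈ tileSupp Pt t) :
    psiIter σ T N G S n z ∈ tileSupp Pt t := by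
  induction n generalizing t z with
  | zero => simpa [psiIter] using hzt
  | succ n ih =>
    obtain ⟨s, hs, hzs⟩ := h.exists_inflatedSubtile ht hz hzt
    have h1 := ih (inflatedSubtile_mem h.selfSimilar ht hs) (h.mapsTo hz) hzs
    rw [psiIter_succ, mem_tileSupp]
    refine subtileSupp_subset hs ((mem_tileSupp_inflatedSubtile (t := t)).1 ?_)
    rwa [sub_add_cancel, smul_inv_smul₀ (σ.lam_pow_ne_zero N)]

theorem psiLim_mem_tileSupp (h : IsInjectivePair σ T N G S) {t : P × Plane} (ht : t ∈ T)
    {z : Plane} (hz : z ∈ G.gammaSet T) (hzt : z ∈ tileSupp Pt t) :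
    psiLim σ T N G S z ∈ tileSupp Pt t :=
  (isClosed_tileSupp t).mem_of_tendsto (h.tendsto_psiLim hz)
    (Eventually.of_forall fun n => h.psiIter_mem_tileSupp n ht hz hzt)

/-- The limit map sends a point into the subtiles that contain its image under `ψ`. -/
theorem psiLim_sub_mem_subtileSupp (h : IsInjectivePair σ T N G S) {t s : P × Plane} (ht : t ∈ T)
    (hs : s ∈ subtiles σ N t.1) {z : Plane} (hz : z ∈ G.gammaSet T)
    (hzs : inflatedPsi σ T N G S z ∈ tileSupp Pt (inflatedSubtile σ N t s)) :
    psiLim σ T N G S z - t.2 ∈ subtileSupp σ N s := by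
  have h1 := h.psiLim_mem_tileSupp (inflatedSubtile_mem h.selfSimilar ht hs) (h.mapsTo hz) hzs
  rw [h.psiLim_inflatedPsi hz] at h1
  refine (mem_tileSupp_inflatedSubtile (t := t)).1 ?_
  rwa [sub_add_cancel]

end IsInjectivePair

end GeomGraph

end FractalTiling

namespace FractalTiling

/-! ### Arcs -/

section Arcs

variable {E : Type*} [MetricSpace E] {h g : ℝ → E}

theorem continuousOn_invFunOn_image {A : Set ℝ} (hA : IsCompact A) (hc : ContinuousOn h A)
    (hi : InjOn h A) : ContinuousOn (Function.invFunOn h A) (h '' A) := by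
  rw [continuousOn_iff_isClosed]
  intro C hC
  refine ⟨h '' (A ∩ C), ((hA.inter_right hC).image_of_continuousOn
    (hc.mono inter_subset_left)).isClosed, ?_⟩
  ext y
  constructor
  · rintro ⟨hy, s, hs, rfl⟩
    rw [mem_preimage, hi.leftInvOn_invFunOn hs] at hy
    exact ⟨⟨s, ⟨hs, hy⟩, rfl⟩, s, hs, rfl⟩
  · rintro ⟨⟨s, ⟨hs, hsC⟩, rfl⟩, hy⟩
    refine ⟨?_, hy⟩
    rwa [mem_preimage, hi.leftInvOn_invFunOn hs]

/-- A curve in an arc is continuous in the parameter of the arc. -/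
theorem exists_lift {A B : Set ℝ} (hA : IsCompact A) (hc : ContinuousOn h A) (hi : InjOn h A)
    (hgc : ContinuousOn g B) (hsub : MapsTo g B (h '' A)) :
    ∃ θ : ℝ → ℝ, ContinuousOn θ B ∧ MapsTo θ B A ∧ ∀ r ∈ B, h (θ r) = g r :=
  ⟨Function.invFunOn h A ∘ g, (continuousOn_invFunOn_image hA hc hi).comp hgc hsub,
    fun _ hr => Function.invFunOn_mem (hsub hr), fun _ hr => Function.invFunOn_eq (hsub hr)⟩

/-- An arc in a set `X` which meets an open arc of `X`, and whose end points do not lie on that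
open arc, contains it. -/
theorem image_Icc_subset_of_mem_nhdsWithin {X : Set E}
    (hc : ContinuousOn h (Icc 0 1)) (hi : InjOn h (Icc 0 1))
    (hgc : ContinuousOn g (Icc 0 1)) (hgi : InjOn g (Icc 0 1))
    (hX : ∀ s ∈ Ioo (0 : ℝ) 1, h '' Ioo 0 1 ∈ 𝓝[X] (h s)) (hgX : MapsTo g (Icc 0 1) X)
    (h0 : g 0 ∉ h '' Ioo 0 1) (h1 : g 1 ∉ h '' Ioo 0 1) {r₀ : ℝ} (hr₀ : r₀ ∈ Icc (0 : ℝ) 1)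
    (hr₀h : g r₀ ∈ h '' Ioo 0 1) : h '' Icc 0 1 ⊆ g '' Icc 0 1 := by
  have hclosed : IsClosed (g '' Icc 0 1) := (isCompact_Icc.image_of_continuousOn hgc).isClosed
  have hIoo : (Ioo 0 1 : Set ℝ) ⊆ Ioo 0 1 ∩ h ⁻¹' (g '' Icc 0 1) := by
    refine isPreconnected_Ioo.subset_of_closure_inter_subset ?_ ?_ ?_
    · rw [isOpen_iff_mem_nhds]
      rintro s ⟨hs, r, hr, hrs⟩
      have hr' : r ∈ Ioo (0 : ℝ) 1 := by
        refine ⟨lt_of_le_of_ne hr.1 ?_, lt_of_le_of_ne hr.2 ?_⟩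
        · rintro rfl
          exact h0 ⟨s, hs, hrs.symm⟩
        · rintro rfl
          exact h1 ⟨s, hs, hrs.symm⟩
      have hev : ∀ᶠ r' in 𝓝 r, r' ∈ Ioo (0 : ℝ) 1 ∧ g r' ∈ h '' Ioo 0 1 := by
        have hnhds := Icc_mem_nhds hr'.1 hr'.2
        have ht : Tendsto g (𝓝 r) (𝓝[X] (h s)) := by
          refine tendsto_nhdsWithin_iff.2 ⟨hrs ▸ hgc.continuousAt hnhds, ?_⟩
          filter_upwards [hnhds] with r' hr' using hgX hr'
        filter_upwards [Ioo_mem_nhds hr'.1 hr'.2, ht (hX s hs)] with r' h₁ h₂ using ⟨h₁, h₂⟩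
      obtain ⟨ε, hε, hball⟩ := Metric.nhds_basis_closedBall.eventually_iff.1 hev
      rw [Real.closedBall_eq_Icc] at hball
      have hsubI : Icc (r - ε) (r + ε) ⊆ Icc 0 1 := fun r' hr' =>
        Ioo_subset_Icc_self (hball hr').1
      obtain ⟨θ, hθc, hθm, hθ⟩ := exists_lift isCompact_Icc hc hi (hgc.mono hsubI)
        (fun r' hr' => image_mono Ioo_subset_Icc_self (hball hr').2)
      have hθI : ∀ r' ∈ Icc (r - ε) (r + ε), θ r' ∈ Ioo (0 : ℝ) 1 := by
        intro r' hr'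
        obtain ⟨u, hu, hur⟩ := (hball hr').2
        rwa [hi (hθm hr') (Ioo_subset_Icc_self hu) ((hθ r' hr').trans hur.symm)]
      have hrI : r ∈ Icc (r - ε) (r + ε) := ⟨by linarith, by linarith⟩
      have hθr : θ r = s := hi (hθm hrI) (Ioo_subset_Icc_self hs) ((hθ r hrI).trans hrs)
      have hθi : InjOn θ (Icc (r - ε) (r + ε)) := fun r₁ h₁ r₂ h₂ he =>
        hgi (hsubI h₁) (hsubI h₂) (by rw [← hθ r₁ h₁, he, hθ r₂ h₂])
      have hle : r - ε ≤ r + ε := by linarith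
      have hmem : θ '' Icc (r - ε) (r + ε) ∈ 𝓝 s := by
        rw [← hθr]
        rcases hθc.strictMonoOn_of_injOn_Icc' hle hθi with hm | hm
        · exact mem_of_superset (Icc_mem_nhds
            (hm (left_mem_Icc.2 hle) hrI (by linarith)) (hm hrI (right_mem_Icc.2 hle) (by linarith)))
            (intermediate_value_Icc hle hθc)
        · exact mem_of_superset (Icc_mem_nhds
            (hm hrI (right_mem_Icc.2 hle) (by linarith)) (hm (left_mem_Icc.2 hle) hrI (by linarith)))
            (intermediate_value_Icc' hle hθc)
      filter_upwards [hmem]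
      rintro _ ⟨r', hr'', rfl⟩
      exact ⟨hθI r' hr'', r', hsubI hr'', (hθ r' hr'').symm⟩
    · obtain ⟨s, hs, hsr⟩ := hr₀h
      exact ⟨s, hs, hs, r₀, hr₀, hsr.symm⟩
    · rintro s ⟨hsc, hs⟩
      refine ⟨hs, ?_⟩
      have hcont : ContinuousAt h s := hc.continuousAt (Icc_mem_nhds hs.1 hs.2)
      exact hclosed.closure_subset (closure_mono (image_subset_iff.2 fun _ hx => hx.2)
        (mem_closure_image hcont hsc))
  rw [← closure_Ioo zero_ne_one] at hc ⊢
  refine (ContinuousOn.image_closure hc).trans (closure_minimal ?_ ?_)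
  · rintro _ ⟨s, hs, rfl⟩
    rw [closure_Ioo zero_ne_one]
    exact (hIoo hs).2
  · rwa [closure_Ioo zero_ne_one]

theorem not_lt_and_lt_of_disjoint_curves {a b : ℝ → ℝ} {ε : ℝ} (hε : 0 < ε)
    (ha : ContinuousOn a (Icc 0 ε)) (hb : ContinuousOn b (Icc 0 ε)) (h0 : a 0 = b 0)
    (hab : ∀ s ∈ Icc 0 ε, ∀ t ∈ Icc 0 ε, a s = b t → s = 0 ∧ t = 0) :
    ¬ (a 0 < a ε ∧ b 0 < b ε) := by
  rintro ⟨h1, h2⟩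
  have hε' : ε ∈ Icc 0 ε := right_mem_Icc.2 hε.le
  rcases le_total (a ε) (b ε) with hle | hle
  · obtain ⟨t, ht, hte⟩ := intermediate_value_Icc hε.le hb ⟨by linarith, hle⟩
    exact hε.ne' (hab ε hε' t ht hte.symm).1
  · obtain ⟨t, ht, hte⟩ := intermediate_value_Icc hε.le ha ⟨by linarith, hle⟩
    exact hε.ne' (hab t ht ε hε' hte).2

/-- Three arcs in `X` with a common end point, but otherwise disjoint, cannot start in an open arc
which is a neighbourhood in `X` of that point. -/
theorem not_tripod_of_mem_nhdsWithin {X : Set E} {c : E} {γ : Fin 3 → ℝ → E}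
    (hc : ContinuousOn h (Icc 0 1)) (hi : InjOn h (Icc 0 1))
    (hX : h '' Ioo 0 1 ∈ 𝓝[X] c) (hγc : ∀ i, ContinuousOn (γ i) (Icc 0 1))
    (hγX : ∀ i, MapsTo (γ i) (Icc 0 1) X) (h0 : ∀ i, γ i 0 = c)
    (hdisj : ∀ i j, i ≠ j → ∀ s ∈ Icc (0 : ℝ) 1, ∀ t ∈ Icc (0 : ℝ) 1, γ i s = γ j t →
      s = 0 ∧ t = 0) : False := by
  have hev : ∀ᶠ r in 𝓝[≥] (0 : ℝ), r ∈ Icc (0 : ℝ) 1 ∧ ∀ i, γ i r ∈ h '' Icc 0 1 := by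
    have hnhds : Icc (0 : ℝ) 1 ∈ 𝓝[≥] (0 : ℝ) := Icc_mem_nhdsGE one_pos
    refine Filter.Eventually.and hnhds (eventually_all.2 fun i => ?_)
    have ht : Tendsto (γ i) (𝓝[≥] 0) (𝓝[X] c) := by
      refine tendsto_nhdsWithin_iff.2 ⟨?_, ?_⟩
      · have := (hγc i).continuousWithinAt (left_mem_Icc.2 zero_le_one)
        rw [ContinuousWithinAt, h0] at this
        exact this.mono_left (nhdsWithin_le_of_mem hnhds)
      · filter_upwards [hnhds] with r hr using hγX i hr
    exact ht (mem_of_superset hX (image_mono Ioo_subset_Icc_self))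
  obtain ⟨ε, hε, hball⟩ := (nhdsGE_basis_Icc (a := (0 : ℝ))).eventually_iff.1 hev
  have hlift := fun i => exists_lift isCompact_Icc hc hi
    ((hγc i).mono fun r hr => (hball hr).1) (fun r hr => (hball hr).2 i)
  choose θ hθc hθm hθ using hlift
  have h0mem : (0 : ℝ) ∈ Icc 0 ε := left_mem_Icc.2 (le_of_lt hε)
  have hεmem : ε ∈ Icc 0 ε := right_mem_Icc.2 (le_of_lt hε)
  have hθd : ∀ i j, i ≠ j → ∀ s ∈ Icc 0 ε, ∀ t ∈ Icc 0 ε, θ i s = θ j t → s = 0 ∧ t = 0 := by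
    intro i j hij s hs t ht he
    exact hdisj i j hij s (hball hs).1 t (hball ht).1 (by rw [← hθ i s hs, he, hθ j t ht])
  have hθ0 : ∀ i j, θ i 0 = θ j 0 := fun i j =>
    hi (hθm i h0mem) (hθm j h0mem) (by rw [hθ i 0 h0mem, hθ j 0 h0mem, h0, h0])
  have hpos : ∀ i j, i ≠ j → ¬ (θ i 0 < θ i ε ∧ θ j 0 < θ j ε) := fun i j hij =>
    not_lt_and_lt_of_disjoint_curves hε (hθc i) (hθc j) (hθ0 i j) (hθd i j hij)
  have hneg : ∀ i j, i ≠ j → ¬ (θ i ε < θ i 0 ∧ θ j ε < θ j 0) := by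
    intro i j hij
    have := not_lt_and_lt_of_disjoint_curves hε (hθc i).neg (hθc j).neg
      (by simp [hθ0 i j]) (fun s hs t ht he => hθd i j hij s hs t ht (neg_injective he))
    simpa using this
  have hne : ∀ i, θ i 0 < θ i ε ∨ θ i ε < θ i 0 := by
    intro i
    obtain ⟨j, hj⟩ : ∃ j, i ≠ j := ⟨i + 1, by fin_cases i <;> decide⟩
    refine lt_or_gt_of_ne fun he => ?_
    exact (ne_of_lt hε) (hθd i j hj ε hεmem 0 h0mem (he.symm.trans (hθ0 i j))).1.symm
  have h01 := hpos 0 1 (by decide)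
  have h02 := hpos 0 2 (by decide)
  have h12 := hpos 1 2 (by decide)
  have n01 := hneg 0 1 (by decide)
  have n02 := hneg 0 2 (by decide)
  have n12 := hneg 1 2 (by decide)
  have e0 := hne 0
  have e1 := hne 1
  have e2 := hne 2
  tauto

/-- An arc contained in another arc is a reparametrization of a sub-arc. -/
theorem exists_reparametrization
    (hc : ContinuousOn h (Icc 0 1)) (hi : InjOn h (Icc 0 1))
    (hgc : ContinuousOn g (Icc 0 1)) (hgi : InjOn g (Icc 0 1))
    (hsub : h '' Icc 0 1 ⊆ g '' Icc 0 1) :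
    ∃ θ : ℝ → ℝ, MapsTo θ (Icc 0 1) (Icc 0 1) ∧ (∀ s ∈ Icc (0 : ℝ) 1, g (θ s) = h s) ∧
      ∀ s ∈ Icc (0 : ℝ) 1, ∀ t ∈ Icc (0 : ℝ) 1,
        eVariationOn h (uIcc s t) = eVariationOn g (uIcc (θ s) (θ t)) := by
  obtain ⟨θ, hθc, hθm, hθ⟩ := exists_lift isCompact_Icc hgc hgi hc (mapsTo_iff_image_subset.2 hsub)
  refine ⟨θ, hθm, hθ, fun s hs t ht => ?_⟩
  have hst : uIcc s t ⊆ Icc 0 1 := uIcc_subset_Icc hs ht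
  have hθi : InjOn θ (Icc 0 1) := fun r₁ h₁ r₂ h₂ he => hi h₁ h₂ (by rw [← hθ r₁ h₁, he, hθ r₂ h₂])
  have heq : eVariationOn h (uIcc s t) = eVariationOn (g ∘ θ) (uIcc s t) :=
    eVariationOn.eq_of_eqOn fun r hr => (hθ r (hst hr)).symm
  rw [heq]
  have hiv : uIcc (θ s) (θ t) ⊆ θ '' uIcc s t := intermediate_value_uIcc (hθc.mono hst)
  rcases hθc.strictMonoOn_of_injOn_Icc' zero_le_one hθi with hm | hm
  · have hm' := (hm.mono hst).monotoneOn
    rw [eVariationOn.comp_eq_of_monotoneOn _ _ hm', hm'.image_uIcc_subset.antisymm hiv]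
  · have hm' := (hm.mono hst).antitoneOn
    rw [eVariationOn.comp_eq_of_antitoneOn _ _ hm', hm'.image_uIcc_subset.antisymm hiv]

theorem eVariationOn_pos (hgi : InjOn g (Icc 0 1)) {s t : ℝ} (hs : 0 ≤ s) (hst : s < t)
    (ht : t ≤ 1) : 0 < eVariationOn g (Icc s t) := by
  refine lt_of_lt_of_le (edist_pos.2 fun he => ?_)
    (eVariationOn.edist_le g (left_mem_Icc.2 hst.le) (right_mem_Icc.2 hst.le))
  exact hst.ne (hgi ⟨hs, by linarith⟩ ⟨by linarith, ht⟩ he)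

theorem eVariationOn_add (g : ℝ → E) {a b c : ℝ} (hab : a ≤ b) (hbc : b ≤ c) :
    eVariationOn g (Icc a b) + eVariationOn g (Icc b c) = eVariationOn g (Icc a c) := by
  simpa using eVariationOn.Icc_add_Icc g (s := univ) hab hbc (mem_univ b)

/-- A proper sub-arc of an arc of finite length is shorter. -/
theorem eVariationOn_lt_of_image_subset
    (hc : ContinuousOn h (Icc 0 1)) (hi : InjOn h (Icc 0 1))
    (hgc : ContinuousOn g (Icc 0 1)) (hgi : InjOn g (Icc 0 1))
    (hsub : h '' Icc 0 1 ⊆ g '' Icc 0 1) (hfin : eVariationOn g (Icc 0 1) ≠ ⊤)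
    (hends : ¬ (g 0 ∈ h '' Icc 0 1 ∧ g 1 ∈ h '' Icc 0 1)) :
    eVariationOn h (Icc 0 1) < eVariationOn g (Icc 0 1) := by
  obtain ⟨θ, hθm, hθ, hvar⟩ := exists_reparametrization hc hi hgc hgi hsub
  have m0 : (0 : ℝ) ∈ Icc (0 : ℝ) 1 := left_mem_Icc.2 zero_le_one
  have m1 : (1 : ℝ) ∈ Icc (0 : ℝ) 1 := right_mem_Icc.2 zero_le_one
  have hv := hvar 0 m0 1 m1
  rw [uIcc_of_le zero_le_one, uIcc] at hv
  rw [hv]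
  set c := θ 0 ⊓ θ 1
  set d := θ 0 ⊔ θ 1
  have hcd : c ≤ d := inf_le_sup
  have hc0 : 0 ≤ c := le_inf (hθm m0).1 (hθm m1).1
  have hd1 : d ≤ 1 := sup_le (hθm m0).2 (hθm m1).2
  have hcim : g c ∈ h '' Icc 0 1 := by
    rcases min_choice (θ 0) (θ 1) with he | he
    · exact ⟨0, m0, by rw [← hθ 0 m0, ← he]⟩
    · exact ⟨1, m1, by rw [← hθ 1 m1, ← he]⟩
  have hdim : g d ∈ h '' Icc 0 1 := by
    rcases max_choice (θ 0) (θ 1) with he | he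
    · exact ⟨0, m0, by rw [← hθ 0 m0, ← he]⟩
    · exact ⟨1, m1, by rw [← hθ 1 m1, ← he]⟩
  have hcdfin : eVariationOn g (Icc c d) ≠ ⊤ :=
    ne_top_of_le_ne_top hfin (eVariationOn.mono g (Icc_subset_Icc hc0 hd1))
  rw [← eVariationOn_add g hc0 (hcd.trans hd1), ← eVariationOn_add g hcd hd1]
  by_cases hc' : c = 0
  · have hd' : d < 1 := lt_of_le_of_ne hd1 fun he => hends ⟨hc' ▸ hcim, he ▸ hdim⟩
    refine lt_of_lt_of_le ?_ le_add_self
    exact ENNReal.lt_add_right hcdfin (eVariationOn_pos hgi (hc0.trans hcd) hd' le_rfl).ne'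
  · have hc'' : 0 < c := lt_of_le_of_ne hc0 (Ne.symm hc')
    rw [← add_assoc, add_comm (eVariationOn g (Icc 0 c))]
    refine lt_of_lt_of_le ?_ le_self_add
    exact ENNReal.lt_add_right hcdfin (eVariationOn_pos hgi le_rfl hc'' (hcd.trans hd1)).ne'

end Arcs

end FractalTiling

namespace FractalTiling

namespace GeomGraph

variable {P : Type*} {Pt : PrototileSet P} {T : Set (P × Plane)} {σ : Substitution Pt}
  {V : P → Type*} [∀ p, Fintype (V p)] {K : ∀ p, SimpleGraph (V p)} {N : ℕ} {G S : GeomGraph Pt K}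

/-! ### Edges in tiles -/

/-- The copy in the tile `t` of the edge `e`. -/
def tileEdge (G : GeomGraph Pt K) (t : P × Plane) (e : Sym2 (V t.1)) : Set Plane :=
  (fun w => G.ι t.1 w + t.2) '' cell e

/-- The copy in the tile `t` of the vertex `v`. -/
noncomputable def tileVertex (G : GeomGraph Pt K) (t : P × Plane) (v : V t.1) : Plane :=
  G.ι t.1 (vertexCoord v) + t.2

/-- The parametrization of the copy in the tile `t` of the edge from `a` to `b`. -/
noncomputable def tilePath (G : GeomGraph Pt K) (t : P × Plane) (a b : V t.1) (s : ℝ) : Plane :=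
  G.ι t.1 (cellPath a b s) + t.2

theorem cellPath_mem_realization {p : P} {a b : V p} (hab : (K p).Adj a b) {s : ℝ}
    (hs : s ∈ Icc (0 : ℝ) 1) : cellPath a b s ∈ realization (K p) :=
  cell_subset_realization (e := s(a, b)) hab (cellPath_mem hs)

theorem continuousOn_ι_cellPath (G : GeomGraph Pt K) {p : P} {a b : V p} (hab : (K p).Adj a b) :
    ContinuousOn (fun s => G.ι p (cellPath a b s)) (Icc 0 1) :=
  (G.continuousOn p).comp (continuous_cellPath a b).continuousOn
    fun _ hs => cellPath_mem_realization hab hs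

theorem injOn_ι_cellPath (G : GeomGraph Pt K) {p : P} {a b : V p} (hab : (K p).Adj a b) :
    InjOn (fun s => G.ι p (cellPath a b s)) (Icc 0 1) := fun _ hs _ ht h =>
  cellPath_injective hab.ne
    (G.injOn p (cellPath_mem_realization hab hs) (cellPath_mem_realization hab ht) h)

theorem continuousOn_tilePath (G : GeomGraph Pt K) {t : P × Plane} {a b : V t.1}
    (hab : (K t.1).Adj a b) : ContinuousOn (G.tilePath t a b) (Icc 0 1) :=
  (G.continuousOn_ι_cellPath hab).add continuousOn_const

theorem injOn_tilePath (G : GeomGraph Pt K) {t : P × Plane} {a b : V t.1}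
    (hab : (K t.1).Adj a b) : InjOn (G.tilePath t a b) (Icc 0 1) :=
  fun _ hs _ ht h => G.injOn_ι_cellPath hab hs ht (add_right_cancel h)

theorem tileEdge_eq_image (G : GeomGraph Pt K) {t : P × Plane} {a b : V t.1}
    (hab : (K t.1).Adj a b) : G.tileEdge t s(a, b) = G.tilePath t a b '' Icc 0 1 := by
  rw [tileEdge, cell_eq_image hab.ne, image_image]
  rfl

theorem tileEdge_subset_gammaSet {t : P × Plane} (ht : t ∈ T) {e : Sym2 (V t.1)}
    (he : e ∈ (K t.1).edgeSet) : G.tileEdge t e ⊆ G.gammaSet T := by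
  rintro _ ⟨w, hw, rfl⟩
  exact mem_gammaSet.2 ⟨t, ht, w, cell_subset_realization he hw, rfl⟩

theorem tileEdge_subset_tileSupp (G : GeomGraph Pt K) {t : P × Plane} {e : Sym2 (V t.1)}
    (he : e ∈ (K t.1).edgeSet) : G.tileEdge t e ⊆ tileSupp Pt t := by
  rintro _ ⟨w, hw, rfl⟩
  exact G.add_mem_tileSupp (cell_subset_realization he hw)

theorem tileVertex_mem_gammaSet {t : P × Plane} (ht : t ∈ T) (v : V t.1) :
    G.tileVertex t v ∈ G.gammaSet T :=
  mem_gammaSet.2 ⟨t, ht, _, G.vertexCoord_mem_realization _ v, rfl⟩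

theorem tileVertex_mem_tileEdge (G : GeomGraph Pt K) {t : P × Plane} {v : V t.1}
    {e : Sym2 (V t.1)} (hv : v ∈ e) : G.tileVertex t v ∈ G.tileEdge t e :=
  ⟨_, vertexCoord_mem_cell_iff.2 hv, rfl⟩

theorem IsConsistent.exists_mem_tileEdge (hT : IsTiling Pt T) (hG : G.IsConsistent T)
    {t : P × Plane} (ht : t ∈ T) {z : Plane} (hz : z ∈ G.gammaSet T) (hzt : z ∈ tileSupp Pt t) :
    ∃ e ∈ (K t.1).edgeSet, z ∈ G.tileEdge t e := by
  obtain ⟨w, hw, rfl⟩ := hG.exists_eq_add hT ht hz hzt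
  obtain ⟨e, he, hwe⟩ := mem_realization.1 hw
  exact ⟨e, he, w, hwe, rfl⟩

/-- A point which is not a vertex lies in only one edge, in its relative interior. -/
theorem exists_tilePath_of_forall_ne (G : GeomGraph Pt K) {t : P × Plane} {a b : V t.1}
    (hab : (K t.1).Adj a b) {z : Plane} (hz : z ∈ G.tileEdge t s(a, b))
    (hv : ∀ v, z ≠ G.tileVertex t v) : z ∈ G.tilePath t a b '' Ioo 0 1 := by
  rw [G.tileEdge_eq_image hab] at hz
  obtain ⟨s, hs, rfl⟩ := hz
  refine ⟨s, ⟨lt_of_le_of_ne hs.1 ?_, lt_of_le_of_ne hs.2 ?_⟩, rfl⟩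
  · rintro rfl
    exact hv a (by simp [tilePath, tileVertex])
  · rintro rfl
    exact hv b (by simp [tilePath, tileVertex])

theorem tilePath_ne_tileVertex (G : GeomGraph Pt K) {t : P × Plane} {a b : V t.1}
    (hab : (K t.1).Adj a b) {s : ℝ} (hs : s ∈ Ioo (0 : ℝ) 1) (v : V t.1) :
    G.tilePath t a b s ≠ G.tileVertex t v := fun h =>
  cellPath_ne_vertexCoord hab.ne hs v
    (G.injOn _ (cellPath_mem_realization hab (Ioo_subset_Icc_self hs))
      (G.vertexCoord_mem_realization _ v) (add_right_cancel h))

/-- Two distinct edges of a tile meet at most in a common vertex. -/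
theorem exists_eq_tileVertex_of_mem_tileEdge (G : GeomGraph Pt K) {t : P × Plane}
    {e f : Sym2 (V t.1)} (he : e ∈ (K t.1).edgeSet) (hf : f ∈ (K t.1).edgeSet) (hne : e ≠ f)
    {z : Plane} (hze : z ∈ G.tileEdge t e) (hzf : z ∈ G.tileEdge t f) :
    ∃ v, v ∈ e ∧ v ∈ f ∧ z = G.tileVertex t v := by
  obtain ⟨w, hwe, rfl⟩ := hze
  obtain ⟨u, huf, huw⟩ := hzf
  obtain rfl := G.injOn _ (cell_subset_realization hf huf) (cell_subset_realization he hwe)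
    (add_right_cancel huw)
  obtain ⟨v, hve, hvf, rfl⟩ := exists_eq_vertexCoord_of_mem_cell hne hwe huf
  exact ⟨v, hve, hvf, rfl⟩

/-- Around a point in the relative interior of an edge, `∂T⁽⁰⁾` coincides with that edge. -/
theorem IsConsistent.tilePath_image_mem_nhdsWithin (hT : IsTiling Pt T) (hG : G.IsConsistent T)
    {t : P × Plane} (ht : t ∈ T) {a b : V t.1} (hab : (K t.1).Adj a b) {s : ℝ}
    (hs : s ∈ Ioo (0 : ℝ) 1) :
    G.tilePath t a b '' Ioo 0 1 ∈ 𝓝[G.gammaSet T] (G.tilePath t a b s) := by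
  have hs' := Ioo_subset_Icc_self hs
  have hr := cellPath_mem_realization hab hs'
  set D : Set (V t.1 → ℝ) := (⋃ e ∈ (K t.1).edgeSet \ {s(a, b)}, cell e) ∪
    {vertexCoord a, vertexCoord b}
  have hDsub : D ⊆ realization (K t.1) := by
    rintro w (hw | rfl | rfl)
    · obtain ⟨e, he, hwe⟩ := mem_iUnion₂.1 hw
      exact cell_subset_realization he.1 hwe
    · exact G.vertexCoord_mem_realization _ _
    · exact G.vertexCoord_mem_realization _ _
  have hDc : IsCompact D :=
    ((Set.toFinite _).isCompact_biUnion fun e _ => isCompact_cell e).union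
      (Set.toFinite _).isCompact
  have hCc : IsClosed ((fun w => G.ι t.1 w + t.2) '' D) :=
    (hDc.image_of_continuousOn
      (((G.continuousOn t.1).mono hDsub).add continuousOn_const)).isClosed
  have hzC : G.tilePath t a b s ∉ (fun w => G.ι t.1 w + t.2) '' D := by
    rintro ⟨w, hw, hwz⟩
    obtain rfl := G.injOn _ (hDsub hw) hr (add_right_cancel hwz)
    rcases hw with hw | hw | hw
    · obtain ⟨e, he, hwe⟩ := mem_iUnion₂.1 hw
      exact he.2 ((cellPath_mem_cell_iff hab.ne hs).1 hwe)
    · exact cellPath_ne_vertexCoord hab.ne hs a hw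
    · exact cellPath_ne_vertexCoord hab.ne hs b hw
  have hint : G.tilePath t a b s ∈ interior (tileSupp Pt t) := by
    rw [mem_interior_tileSupp, tilePath, add_sub_cancel_right]
    refine (mem_supp_iff_interior_or_frontier.1 (G.mapsTo _ hr)).resolve_right fun hf => ?_
    obtain ⟨v, hv, -⟩ := hG.exists_vertexCoord hr hf
    exact cellPath_ne_vertexCoord hab.ne hs v hv
  refine mem_nhdsWithin.2 ⟨_, isOpen_interior.inter hCc.isOpen_compl, ⟨hint, hzC⟩, ?_⟩
  rintro y ⟨⟨hyi, hyC⟩, hy⟩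
  obtain ⟨w, hw, rfl⟩ := hG.exists_eq_add hT ht hy (interior_subset hyi)
  obtain ⟨e, he, hwe⟩ := mem_realization.1 hw
  by_cases hes : e = s(a, b)
  · subst hes
    refine G.exists_tilePath_of_forall_ne hab ⟨w, hwe, rfl⟩ fun v hv => ?_
    obtain rfl := G.injOn _ hw (G.vertexCoord_mem_realization _ v) (add_right_cancel hv)
    refine hyC ⟨_, Or.inr ?_, rfl⟩
    rcases Sym2.mem_iff.1 (vertexCoord_mem_cell_iff.1 hwe) with rfl | rfl <;> simp
  · exact absurd ⟨w, Or.inl (mem_biUnion (show e ∈ (K t.1).edgeSet \ {s(a, b)} from ⟨he, hes⟩) hwe),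
      rfl⟩ hyC

/-! ### Inflated edges -/

theorem continuousOn_smul_tilePath (σ : Substitution Pt) (N : ℕ) (S : GeomGraph Pt K)
    {t : P × Plane} {a b : V t.1} (hab : (K t.1).Adj a b) :
    ContinuousOn (fun s => σ.lam ^ N • S.tilePath t a b s) (Icc 0 1) :=
  (continuous_const_smul (σ.lam ^ N)).comp_continuousOn (S.continuousOn_tilePath hab)

theorem injOn_smul_tilePath (σ : Substitution Pt) (N : ℕ) (S : GeomGraph Pt K)
    {t : P × Plane} {a b : V t.1} (hab : (K t.1).Adj a b) :
    InjOn (fun s => σ.lam ^ N • S.tilePath t a b s) (Icc 0 1) := fun _ hr _ hs he =>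
  S.injOn_tilePath hab hr hs (smul_right_injective _ (σ.lam_pow_ne_zero N) he)

/-- `t'` is the inflation of an `N`-subtile of the tile `t`. -/
def IsChild (σ : Substitution Pt) (N : ℕ) (t t' : P × Plane) : Prop :=
  ∃ s ∈ subtiles σ N t.1, t' = inflatedSubtile σ N t s

theorem IsChild.mem_interior {t t' : P × Plane} (hc : IsChild σ N t t') {z : Plane}
    (hz : σ.lam ^ N • (z + t.2) ∈ interior (tileSupp Pt t')) : z ∈ interior (Pt.supp t.1) := by
  obtain ⟨s, hs, rfl⟩ := hc
  have hcont : Continuous fun z : Plane => σ.lam ^ N • (z + t.2) := by fun_prop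
  refine interior_maximal ?_ (isOpen_interior.preimage hcont) hz
  intro y hy
  exact subtileSupp_subset hs (mem_tileSupp_inflatedSubtile.1 (interior_subset hy))

namespace IsInjectivePair

theorem child_mem (h : IsInjectivePair σ T N G S) {t t' : P × Plane} (ht : t ∈ T)
    (hc : IsChild σ N t t') : t' ∈ T := by
  obtain ⟨s, hs, rfl⟩ := hc
  exact inflatedSubtile_mem h.selfSimilar ht hs

variable [Finite P]

theorem inflatedPsi_tileVertex (h : IsInjectivePair σ T N G S) {t : P × Plane} (ht : t ∈ T)
    (v : V t.1) :
    inflatedPsi σ T N G S (G.tileVertex t v) = σ.lam ^ N • S.tileVertex t v :=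
  h.inflatedPsi_eq ht (G.vertexCoord_mem_realization _ v)

theorem inflatedPsi_tilePath (h : IsInjectivePair σ T N G S) {t : P × Plane} (ht : t ∈ T)
    {a b : V t.1} (hab : (K t.1).Adj a b) {s : ℝ} (hs : s ∈ Icc (0 : ℝ) 1) :
    inflatedPsi σ T N G S (G.tilePath t a b s) = σ.lam ^ N • S.tilePath t a b s :=
  h.inflatedPsi_eq ht (cellPath_mem_realization hab hs)

theorem smul_tilePath_mem_gammaSet (h : IsInjectivePair σ T N G S) {t : P × Plane} (ht : t ∈ T)
    {a b : V t.1} (hab : (K t.1).Adj a b) {s : ℝ} (hs : s ∈ Icc (0 : ℝ) 1) :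
    σ.lam ^ N • S.tilePath t a b s ∈ G.gammaSet T := by
  rw [← h.inflatedPsi_tilePath ht hab hs]
  exact h.mapsTo (mem_gammaSet.2 ⟨t, ht, _, cellPath_mem_realization hab hs, rfl⟩)

/-- The map `λ^N ψ` takes vertices to vertices. -/
theorem exists_eq_tileVertex (h : IsInjectivePair σ T N G S) {t t' : P × Plane} (ht : t ∈ T)
    (hc : IsChild σ N t t') (v : V t.1)
    (hv : inflatedPsi σ T N G S (G.tileVertex t v) ∈ tileSupp Pt t') :
    ∃ u, inflatedPsi σ T N G S (G.tileVertex t v) = G.tileVertex t' u := by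
  have ht' := h.child_mem ht hc
  have hG := h.recurrent.consistent_left
  by_cases hb : G.IsBoundaryVertex t.1 v
  · obtain ⟨w, hw, hwe⟩ := hG.exists_eq_add h.tiling ht'
      (h.mapsTo (tileVertex_mem_gammaSet ht v)) hv
    have hf : G.ι t'.1 w ∈ frontier (Pt.supp t'.1) := by
      refine (mem_supp_iff_interior_or_frontier.1 (G.mapsTo _ hw)).resolve_left fun hi => ?_
      have hi' : inflatedPsi σ T N G S (G.tileVertex t v) ∈ interior (tileSupp Pt t') := by
        rw [mem_interior_tileSupp, hwe, add_sub_cancel_right]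
        exact hi
      rw [h.inflatedPsi_tileVertex ht v] at hi'
      exact ((h.recurrent.boundary_iff _ _).1 hb).2 (hc.mem_interior hi')
    obtain ⟨u, rfl, -⟩ := hG.exists_vertexCoord hw hf
    exact ⟨u, hwe⟩
  · by_contra! hcon
    obtain ⟨f, hf, hvf⟩ := hG.exists_mem_tileEdge h.tiling ht'
      (h.mapsTo (tileVertex_mem_gammaSet ht v)) hv
    induction f with | _ c d
    obtain ⟨r, hr, hre⟩ := G.exists_tilePath_of_forall_ne hf hvf hcon
    have hdeg : 3 ≤ ((K t.1).neighborSet v).ncard := by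
      refine h.quasiDual.degree _ _ ((mem_supp_iff_interior_or_frontier.1
        (G.carrier_subset _ (G.vertex_mem_carrier _ v))).resolve_right hb)
    obtain ⟨a, ha⟩ : ∃ a : Fin 3 → V t.1, Function.Injective a ∧ ∀ i, (K t.1).Adj v (a i) := by
      classical
      rw [← Nat.card_coe_set_eq, Nat.card_eq_fintype_card] at hdeg
      obtain ⟨a⟩ := Function.Embedding.nonempty_of_card_le
        (α := Fin 3) (β := (K t.1).neighborSet v) (by simpa using hdeg)
      exact ⟨fun i => a i, Subtype.val_injective.comp a.injective, fun i => (a i).2⟩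
    refine not_tripod_of_mem_nhdsWithin (X := G.gammaSet T)
      (γ := fun i s => σ.lam ^ N • S.tilePath t v (a i) s)
      (G.continuousOn_tilePath hf) (G.injOn_tilePath hf)
      (hG.tilePath_image_mem_nhdsWithin h.tiling ht' hf hr)
      (fun i => continuousOn_smul_tilePath σ N S (ha.2 i))
      (fun i s hs => h.smul_tilePath_mem_gammaSet ht (ha.2 i) hs)
      (fun i => ?_) fun i j hij r hr s hs he => ?_
    · rw [hre, h.inflatedPsi_tileVertex ht v]
      simp [tilePath, tileVertex]
    · have he' : cellPath v (a i) r = cellPath v (a j) s :=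
        S.injOn _ (cellPath_mem_realization (ha.2 i) hr) (cellPath_mem_realization (ha.2 j) hs)
          (add_right_cancel (smul_right_injective _ (σ.lam_pow_ne_zero N) he))
      have hz : ∀ i j, i ≠ j → ∀ s, cellPath v (a j) s (a i) = 0 := by
        classical
        intro i j hij s
        simp [cellPath, vertexCoord_apply, (ha.2 i).ne.symm, ha.1.ne hij]
      constructor
      · rw [← cellPath_apply_right (ha.2 i).ne r, he', hz i j hij]
      · rw [← cellPath_apply_right (ha.2 j).ne s, ← he', hz j i hij.symm]

/-- If the image under `λ^N ψ` of the edge `e` meets the relative interior of the edge `f`, then it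
contains `f`. -/
theorem tilePath_image_subset (h : IsInjectivePair σ T N G S) {t t' : P × Plane} (ht : t ∈ T)
    (hc : IsChild σ N t t') {a b : V t.1} (hab : (K t.1).Adj a b) {c d : V t'.1}
    (hcd : (K t'.1).Adj c d) {z : Plane} (hz : z ∈ G.tileEdge t s(a, b))
    (hzf : inflatedPsi σ T N G S z ∈ G.tileEdge t' s(c, d))
    (hzv : ∀ v, inflatedPsi σ T N G S z ≠ G.tileVertex t' v) :
    G.tilePath t' c d '' Icc 0 1 ⊆ (fun s => σ.lam ^ N • S.tilePath t a b s) '' Icc 0 1 := by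
  have ht' := h.child_mem ht hc
  rw [G.tileEdge_eq_image hab] at hz
  obtain ⟨r, hr, rfl⟩ := hz
  have hvert : ∀ v, σ.lam ^ N • S.tileVertex t v ∉ G.tilePath t' c d '' Ioo 0 1 := by
    rintro v ⟨s, hs, hse⟩
    rw [← h.inflatedPsi_tileVertex ht] at hse
    obtain ⟨u, hu⟩ := h.exists_eq_tileVertex ht hc v
      (hse ▸ G.add_mem_tileSupp (cellPath_mem_realization hcd (Ioo_subset_Icc_self hs)))
    exact G.tilePath_ne_tileVertex hcd hs u (hse.trans hu)
  refine image_Icc_subset_of_mem_nhdsWithin (X := G.gammaSet T)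
    (G.continuousOn_tilePath hcd) (G.injOn_tilePath hcd)
    (continuousOn_smul_tilePath σ N S hab) (injOn_smul_tilePath σ N S hab)
    (fun s hs => h.recurrent.consistent_left.tilePath_image_mem_nhdsWithin h.tiling ht' hcd hs)
    (fun s hs => h.smul_tilePath_mem_gammaSet ht hab hs) ?_ ?_ hr ?_
  · have := hvert a
    simpa [tilePath, tileVertex] using this
  · have := hvert b
    simpa [tilePath, tileVertex] using this
  · rw [← h.inflatedPsi_tilePath ht hab hr]
    exact G.exists_tilePath_of_forall_ne hcd hzf hzv

theorem tileEdge_subset_image (h : IsInjectivePair σ T N G S) {t t' : P × Plane} (ht : t ∈ T)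
    (hc : IsChild σ N t t') {e : Sym2 (V t.1)} (he : e ∈ (K t.1).edgeSet) {f : Sym2 (V t'.1)}
    (hf : f ∈ (K t'.1).edgeSet) {z : Plane} (hz : z ∈ G.tileEdge t e)
    (hzf : inflatedPsi σ T N G S z ∈ G.tileEdge t' f)
    (hzv : ∀ v, inflatedPsi σ T N G S z ≠ G.tileVertex t' v) :
    G.tileEdge t' f ⊆ inflatedPsi σ T N G S '' G.tileEdge t e := by
  induction e with | _ a b
  induction f with | _ c d
  have := h.tilePath_image_subset ht hc he hf hz hzf hzv
  rw [G.tileEdge_eq_image he, G.tileEdge_eq_image hf, image_image]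
  refine this.trans_eq (image_congr fun s hs => ?_)
  exact (h.inflatedPsi_tilePath ht he hs).symm

end IsInjectivePair

end GeomGraph

end FractalTiling

namespace FractalTiling

namespace GeomGraph

variable {P : Type*} {Pt : PrototileSet P} {T : Set (P × Plane)} {σ : Substitution Pt}
  {V : P → Type*} [∀ p, Fintype (V p)] {K : ∀ p, SimpleGraph (V p)} {N : ℕ} {G S : GeomGraph Pt K}

/-! ### Separation of edges by subtiles -/

namespace IsInjectivePair

theorem exists_common_vertex (h : IsInjectivePair σ T N G S) {p : P} {e f : Sym2 (V p)}
    (he : e ∈ (K p).edgeSet) (hf : f ∈ (K p).edgeSet) (hne : e ≠ f) {s : P × Plane}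
    (hse : s ∈ subpatch σ N p (S.edge p e)) (hsf : s ∈ subpatch σ N p (S.edge p f)) :
    ∃ v, v ∈ e ∧ v ∈ f ∧ S.vertex p v ∈ subtileSupp σ N s ∧
      subtileSupp σ N s ⊆ interior (Pt.supp p) := by
  obtain ⟨v, hve, hvf⟩ := (h.injectivity.i1 p e he f hf hne).1
    (interior_subpatchSupp_inter_nonempty hse hsf)
  obtain ⟨heq, s', hs', hint⟩ := h.injectivity.i2 p e he f hf hne v hve hvf
  have hs : s ∈ subpatch σ N p {S.vertex p v} := heq ▸ ⟨hse, hsf⟩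
  obtain ⟨-, y, hys, rfl⟩ := id hs
  rw [hs'] at hs
  obtain rfl : s = s' := hs
  exact ⟨v, hve, hvf, hys, hint⟩

theorem exists_adj_ne_ne (h : IsInjectivePair σ T N G S) {p : P} {v : V p}
    (hv : ¬ G.IsBoundaryVertex p v) (x y : V p) : ∃ b, (K p).Adj v b ∧ b ≠ x ∧ b ≠ y := by
  by_contra! hcon
  have hdeg := h.quasiDual.degree p v ((mem_supp_iff_interior_or_frontier.1
    (G.carrier_subset _ (G.vertex_mem_carrier _ v))).resolve_right hv)
  have hsub : (K p).neighborSet v ⊆ {x, y} := fun b hb => or_iff_not_imp_left.2 (hcon b hb)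
  have := (ncard_le_ncard hsub).trans (ncard_insert_le x {y})
  rw [ncard_singleton] at this
  omega

/-- The subtiles at an interior vertex lie in the interior of the tile. -/
theorem subtileSupp_subset_interior (h : IsInjectivePair σ T N G S) {p : P} {v : V p}
    (hv : ¬ G.IsBoundaryVertex p v) {s : P × Plane} (hs : s ∈ subtiles σ N p)
    (hvs : S.vertex p v ∈ subtileSupp σ N s) : subtileSupp σ N s ⊆ interior (Pt.supp p) := by
  obtain ⟨b, hb, -, -⟩ := h.exists_adj_ne_ne hv v v
  obtain ⟨c, hc, hcb, -⟩ := h.exists_adj_ne_ne hv b b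
  have hne : s(v, b) ≠ s(v, c) := fun he => hcb (Sym2.congr_right.1 he).symm
  obtain ⟨v', -, -, -, hint⟩ := h.exists_common_vertex (e := s(v, b)) (f := s(v, c)) hb hc hne
    (mem_subpatch hs hvs ((S.vertex_mem_edge_iff (e := s(v, b)) hb).2 (by simp)))
    (mem_subpatch hs hvs ((S.vertex_mem_edge_iff (e := s(v, c)) hc).2 (by simp)))
  exact hint

/-- The patch of an edge meets the boundary of the prototile only in the open edge which contains
the boundary vertex of that edge. -/
theorem subpatchSupp_inter_frontier_subset (h : IsInjectivePair σ T N G S) {p : P} {e : Sym2 (V p)}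
    (he : e ∈ (K p).edgeSet) {v : V p} (hv : v ∈ e) (hb : G.IsBoundaryVertex p v) {o : Set Plane}
    (ho : IsOpenEdge Pt T p o) (hvo : S.vertex p v ∈ o) :
    subpatchSupp σ N p (S.edge p e) ∩ frontier (Pt.supp p) ⊆ o := by
  have hve := (S.vertex_mem_edge_iff he).2 hv
  have hvf : S.vertex p v ∈ frontier (Pt.supp p) := (h.recurrent.boundary_iff p v).1 hb
  have hconn := (h.injectivity.i4 p e he).2 ⟨_, hve, hvf⟩
  obtain ⟨s, hs, hvs⟩ := exists_subtile (σ := σ) (N := N) (frontier_supp_subset p hvf)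
  refine ho.subset_of_isPreconnected hconn.isPreconnected ?_
    ⟨_, hvo, mem_subpatchSupp hs hvs hve hvs, hvf⟩
  rintro y ⟨hy, hyf⟩
  refine ⟨hyf, ?_⟩
  obtain ⟨s', ⟨hs', z, hzs', w, hw, rfl⟩, hys'⟩ := mem_iUnion₂.1 hy
  exact h.notMem_tileVertices hs' (cell_subset_realization he hw) hzs' hys'

theorem exists_boundaryVertex_of_mem_frontier (h : IsInjectivePair σ T N G S) {p : P}
    {e : Sym2 (V p)} (he : e ∈ (K p).edgeSet) {y : Plane}
    (hy : y ∈ subpatchSupp σ N p (S.edge p e)) (hyf : y ∈ frontier (Pt.supp p)) :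
    ∃ v ∈ e, G.IsBoundaryVertex p v ∧ ∃ o, IsOpenEdge Pt T p o ∧ G.vertex p v ∈ o ∧ y ∈ o := by
  obtain ⟨_, ⟨w, hw, rfl⟩, hzf⟩ := (h.injectivity.i4 p e he).1.1 ⟨y, hy, hyf⟩
  obtain ⟨v, rfl, hv⟩ := h.recurrent.consistent_right.exists_vertexCoord
    (cell_subset_realization he hw) hzf
  have hve := vertexCoord_mem_cell_iff.1 hw
  have hb := (h.recurrent.boundary_iff p v).2 hv
  obtain ⟨o, ho, hGo, hSo, -⟩ := h.exists_openEdge hb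
  exact ⟨v, hve, hb, o, ho, hGo,
    h.subpatchSupp_inter_frontier_subset he hve hb ho hSo ⟨hy, hyf⟩⟩

/-- An edge has at most one boundary vertex. -/
theorem not_isBoundaryVertex_of_adj (h : IsInjectivePair σ T N G S) {p : P} {a b : V p}
    (hab : (K p).Adj a b) (ha : G.IsBoundaryVertex p a) : ¬ G.IsBoundaryVertex p b := by
  intro hb
  obtain ⟨o, ho, -, hSo, huniq⟩ := h.exists_openEdge ha
  obtain ⟨o', ho', hGo', hSo', -⟩ := h.exists_openEdge hb
  have hbf : S.vertex p b ∈ frontier (Pt.supp p) := (h.recurrent.boundary_iff p b).1 hb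
  obtain ⟨s, hs, hbs⟩ := exists_subtile (σ := σ) (N := N) (frontier_supp_subset p hbf)
  have hbo := h.subpatchSupp_inter_frontier_subset (e := s(a, b)) hab (Sym2.mem_mk_left a b) ha ho
    hSo ⟨mem_subpatchSupp hs hbs ((S.vertex_mem_edge_iff (e := s(a, b)) hab).2
      (Sym2.mem_mk_right a b)) hbs, hbf⟩
  exact hab.ne (huniq b hb
    (ho.subset_of_isPreconnected ho'.isPreconnected ho'.subset_diff ⟨_, hbo, hSo'⟩ hGo')).symm

theorem eq_of_isBoundaryVertex (h : IsInjectivePair σ T N G S) {p : P} {e : Sym2 (V p)}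
    (he : e ∈ (K p).edgeSet) {a b : V p} (ha : a ∈ e) (hb : b ∈ e)
    (hab : G.IsBoundaryVertex p a) (hbb : G.IsBoundaryVertex p b) : a = b := by
  by_contra hne
  rw [(Sym2.mem_and_mem_iff hne).1 ⟨ha, hb⟩] at he
  exact h.not_isBoundaryVertex_of_adj he hab hbb

/-- The end points of an edge are separated by the subtiles. -/
theorem not_mem_subtileSupp_of_adj (h : IsInjectivePair σ T N G S) {p : P} {a b : V p}
    (hab : (K p).Adj a b) {s : P × Plane} (hs : s ∈ subtiles σ N p)
    (has : S.vertex p a ∈ subtileSupp σ N s) : S.vertex p b ∉ subtileSupp σ N s := by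
  intro hbs
  by_cases ha : G.IsBoundaryVertex p a
  · exact (h.subtileSupp_subset_interior (h.not_isBoundaryVertex_of_adj hab ha) hs hbs has |>
      fun hi => ((h.recurrent.boundary_iff p a).1 ha).2 hi)
  by_cases hb : G.IsBoundaryVertex p b
  · exact (h.subtileSupp_subset_interior ha hs has hbs |>
      fun hi => ((h.recurrent.boundary_iff p b).1 hb).2 hi)
  obtain ⟨a', haa', ha'b, -⟩ := h.exists_adj_ne_ne ha b b
  obtain ⟨b', hbb', hb'a, hb'a'⟩ := h.exists_adj_ne_ne hb a a'
  have hne : s(a, a') ≠ s(b, b') := by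
    rw [Ne, Sym2.eq_iff, not_or]
    exact ⟨fun hh => hab.ne hh.1, fun hh => hb'a hh.1.symm⟩
  obtain ⟨v, hva, hvb, -, -⟩ := h.exists_common_vertex (e := s(a, a')) (f := s(b, b')) haa' hbb' hne
    (mem_subpatch hs has ((S.vertex_mem_edge_iff (e := s(a, a')) haa').2 (by simp)))
    (mem_subpatch hs hbs ((S.vertex_mem_edge_iff (e := s(b, b')) hbb').2 (by simp)))
  rcases Sym2.mem_iff.1 hva with rfl | rfl <;> rcases Sym2.mem_iff.1 hvb with h' | h'
  · exact hab.ne h'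
  · exact hb'a h'.symm
  · exact ha'b h'
  · exact hb'a' h'.symm

/-- A vertex is separated by the subtiles from the edges that do not contain it. -/
theorem not_mem_subtileSupp_of_notMem (h : IsInjectivePair σ T N G S) {p : P} {u : V p}
    {f : Sym2 (V p)} (hf : f ∈ (K p).edgeSet) (hu : u ∉ f) {s : P × Plane}
    (hs : s ∈ subtiles σ N p) (hus : S.vertex p u ∈ subtileSupp σ N s) {w : V p → ℝ}
    (hw : w ∈ cell f) : S.ι p w ∉ subtileSupp σ N s := by
  intro hws
  have key : ∀ x, (K p).Adj u x → x ∈ f ∧ subtileSupp σ N s ⊆ interior (Pt.supp p) := by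
    intro x hx
    have hne : s(u, x) ≠ f := fun he => hu (he ▸ Sym2.mem_mk_left u x)
    obtain ⟨v, hvu, hvf, -, hint⟩ := h.exists_common_vertex (e := s(u, x)) hx hf hne
      (mem_subpatch hs hus ((S.vertex_mem_edge_iff (e := s(u, x)) hx).2 (by simp)))
      (mem_subpatch hs hws ⟨w, hw, rfl⟩)
    rcases Sym2.mem_iff.1 hvu with rfl | rfl
    · exact absurd hvf hu
    · exact ⟨hvf, hint⟩
  by_cases hb : G.IsBoundaryVertex p u
  · obtain ⟨x, hx⟩ := G.exists_adj p u
    exact ((h.recurrent.boundary_iff p u).1 hb).2 ((key x hx).2 hus)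
  · induction f with | _ c d
    obtain ⟨x, hx, hxc, hxd⟩ := h.exists_adj_ne_ne hb c d
    rcases Sym2.mem_iff.1 (key x hx).1 with h' | h'
    · exact hxc h'
    · exact hxd h'

end IsInjectivePair

end GeomGraph

end FractalTiling

namespace FractalTiling

theorem eVariationOn_const_smul {E : Type*} [NormedAddCommGroup E] [NormedSpace ℝ E] (c : ℝ)
    (f : ℝ → E) (A : Set ℝ) :
    eVariationOn (fun s => c • f s) A = (‖c‖₊ : ENNReal) * eVariationOn f A := by
  simp only [eVariationOn, edist_smul₀, ENNReal.mul_iSup, ENNReal.smul_def, smul_eq_mul,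
    Finset.mul_sum]

theorem eVariationOn_add_const {E : Type*} [NormedAddCommGroup E] (f : ℝ → E) (x : E)
    (A : Set ℝ) : eVariationOn (fun s => f s + x) A = eVariationOn f A := by
  simp only [eVariationOn, edist_add_right]

theorem exists_uniform_ratio {ι : Type*} [Finite ι] (A B : ι → ENNReal) :
    ∃ ρ : ENNReal, 1 < ρ ∧ ∀ i, A i < B i → ρ * A i ≤ B i := by
  have hev : ∀ᶠ ρ in 𝓝[>] (1 : ENNReal), ∀ i, A i < B i → ρ * A i ≤ B i := by
    refine eventually_all.2 fun i => ?_
    by_cases hi : A i < B i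
    · have ht : Tendsto (fun ρ : ENNReal => ρ * A i) (𝓝[>] 1) (𝓝 (1 * A i)) :=
        (ENNReal.Tendsto.mul_const tendsto_id (Or.inl one_ne_zero)).mono_left nhdsWithin_le_nhds
      rw [one_mul] at ht
      filter_upwards [ht.eventually_lt_const hi] with ρ hρ _ using hρ.le
    · exact Eventually.of_forall fun _ h => absurd h hi
  have : (𝓝[>] (1 : ENNReal)).NeBot := nhdsGT_neBot_of_exists_gt ⟨2, by norm_num⟩
  obtain ⟨ρ, hρ, h1⟩ := (hev.and self_mem_nhdsWithin).exists
  exact ⟨ρ, h1, hρ⟩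

namespace GeomGraph

variable {P : Type*} {Pt : PrototileSet P} {T : Set (P × Plane)} {σ : Substitution Pt}
  {V : P → Type*} [∀ p, Fintype (V p)] {K : ∀ p, SimpleGraph (V p)} {N : ℕ} {G S : GeomGraph Pt K}

/-! ### Expansion -/

theorem eVariationOn_tilePath (G : GeomGraph Pt K) (t : P × Plane) (a b : V t.1) (A : Set ℝ) :
    eVariationOn (G.tilePath t a b) A = eVariationOn (G.edgePath t.1 a b) A :=
  eVariationOn_add_const _ t.2 A

theorem mem_of_tileVertex_mem_tileEdge (G : GeomGraph Pt K) {t : P × Plane}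
    {e : Sym2 (V t.1)} (he : e ∈ (K t.1).edgeSet) {v : V t.1}
    (hv : G.tileVertex t v ∈ G.tileEdge t e) : v ∈ e := by
  obtain ⟨w, hw, hwv⟩ := hv
  obtain rfl := G.injOn _ (cell_subset_realization he hw) (G.vertexCoord_mem_realization _ v)
    (add_right_cancel hwv)
  exact vertexCoord_mem_cell_iff.1 hw

namespace IsInjectivePair

theorem exists_speed (h : IsInjectivePair σ T N G S) (t : P × Plane) {a b : V t.1}
    (hab : (K t.1).Adj a b) : eVariationOn (G.tilePath t a b) (Icc 0 1) ≠ ⊤ ∧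
      ∃ k : NNReal, ∀ r ∈ Icc (0 : ℝ) 1, ∀ s ∈ Icc (0 : ℝ) 1,
        eVariationOn (fun s => σ.lam ^ N • S.tilePath t a b s) (uIcc r s) =
          k * eVariationOn (G.tilePath t a b) (uIcc r s) := by
  obtain ⟨hfin, k, hk⟩ := h.constantSpeed t.1 a b hab
  refine ⟨by rwa [eVariationOn_tilePath], ‖σ.lam ^ N‖₊ * k, fun r hr s hs => ?_⟩
  rw [eVariationOn_const_smul, eVariationOn_tilePath, eVariationOn_tilePath, uIcc,
    hk _ _ (le_inf hr.1 hs.1) inf_le_sup (sup_le hr.2 hs.2), ENNReal.coe_mul, mul_assoc]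

variable [Finite P]

/-- The end points of an edge of a tile are separated by the children of the tile. -/
theorem notMem_child_of_adj (h : IsInjectivePair σ T N G S) {t t' : P × Plane} (ht : t ∈ T)
    (hc : IsChild σ N t t') {a b : V t.1} (hab : (K t.1).Adj a b)
    (ha : inflatedPsi σ T N G S (G.tileVertex t a) ∈ tileSupp Pt t') :
    inflatedPsi σ T N G S (G.tileVertex t b) ∉ tileSupp Pt t' := by
  obtain ⟨s, hs, rfl⟩ := hc
  intro hb
  exact h.not_mem_subtileSupp_of_adj hab hs
    ((h.inflatedPsi_mem_tileSupp_iff ht (G.vertexCoord_mem_realization _ a)).1 ha)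
    ((h.inflatedPsi_mem_tileSupp_iff ht (G.vertexCoord_mem_realization _ b)).1 hb)

/-- Uniformly over all edges `e`, an edge that is contained in the image of `e` under `λ^N ψ` is
shorter than this image by at least a fixed factor. -/
theorem exists_ratio (h : IsInjectivePair σ T N G S) :
    ∃ ρ : ENNReal, 1 < ρ ∧ ∀ t ∈ T, ∀ t', IsChild σ N t t' → ∀ a b : V t.1, (K t.1).Adj a b →
      ∀ c d : V t'.1, (K t'.1).Adj c d →
      G.tilePath t' c d '' Icc 0 1 ⊆ (fun s => σ.lam ^ N • S.tilePath t a b s) '' Icc 0 1 →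
      ρ * eVariationOn (G.tilePath t' c d) (Icc 0 1) ≤
        eVariationOn (fun s => σ.lam ^ N • S.tilePath t a b s) (Icc 0 1) := by
  obtain ⟨ρ, hρ, hle⟩ := exists_uniform_ratio
    (ι := (Σ p, V p × V p) × (Σ p, V p × V p))
    (fun i => eVariationOn (G.edgePath i.1.1 i.1.2.1 i.1.2.2) (Icc 0 1))
    (fun i => ‖σ.lam ^ N‖₊ * eVariationOn (S.edgePath i.2.1 i.2.2.1 i.2.2.2) (Icc 0 1))
  refine ⟨ρ, hρ, fun t ht t' hc a b hab c d hcd hsub => ?_⟩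
  have hlt : eVariationOn (G.tilePath t' c d) (Icc 0 1) <
      eVariationOn (fun s => σ.lam ^ N • S.tilePath t a b s) (Icc 0 1) := by
    refine eVariationOn_lt_of_image_subset (G.continuousOn_tilePath hcd) (G.injOn_tilePath hcd)
      (continuousOn_smul_tilePath σ N S hab) (injOn_smul_tilePath σ N S hab) hsub ?_ ?_
    · obtain ⟨hfin, k, hk⟩ := h.exists_speed t hab
      have := hk 0 (left_mem_Icc.2 zero_le_one) 1 (right_mem_Icc.2 zero_le_one)
      rw [uIcc_of_le zero_le_one] at this
      rw [this]
      exact ENNReal.mul_ne_top ENNReal.coe_ne_top hfin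
    · have himg : ∀ y ∈ G.tilePath t' c d '' Icc 0 1, y ∈ tileSupp Pt t' := by
        rintro _ ⟨s, hs, rfl⟩
        exact G.add_mem_tileSupp (cellPath_mem_realization hcd hs)
      rintro ⟨h0, h1⟩
      refine h.notMem_child_of_adj ht hc hab ?_ ?_
      · rw [h.inflatedPsi_tileVertex ht]
        simpa [tilePath, tileVertex] using himg _ h0
      · rw [h.inflatedPsi_tileVertex ht]
        simpa [tilePath, tileVertex] using himg _ h1
  rw [eVariationOn_const_smul, eVariationOn_tilePath, eVariationOn_tilePath] at hlt ⊢
  exact hle (⟨t'.1, c, d⟩, ⟨t.1, a, b⟩) hlt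

/-- Two points whose images under all iterates of `λ^N ψ` lie in common edges of successive tiles
are equal. -/
theorem eq_of_common_edges (h : IsInjectivePair σ T N G S) (Q : P × Plane → Plane → Plane → Prop)
    (hQT : ∀ t z₁ z₂, Q t z₁ z₂ → t ∈ T)
    (hQe : ∀ t z₁ z₂, Q t z₁ z₂ →
      ∃ e ∈ (K t.1).edgeSet, z₁ ∈ G.tileEdge t e ∧ z₂ ∈ G.tileEdge t e)
    (hQc : ∀ t z₁ z₂, Q t z₁ z₂ → ∃ t', IsChild σ N t t' ∧
      Q t' (inflatedPsi σ T N G S z₁) (inflatedPsi σ T N G S z₂))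
    {t : P × Plane} {z₁ z₂ : Plane} (hQ : Q t z₁ z₂) : z₁ = z₂ := by
  obtain ⟨ρ, hρ, hratio⟩ := h.exists_ratio
  have key : ∀ n : ℕ, ∀ t z₁ z₂, Q t z₁ z₂ → z₁ ≠ z₂ → ∀ a b : V t.1, (K t.1).Adj a b →
      ∀ r₁ ∈ Icc (0 : ℝ) 1, ∀ r₂ ∈ Icc (0 : ℝ) 1, G.tilePath t a b r₁ = z₁ →
      G.tilePath t a b r₂ = z₂ →
      ρ ^ n * eVariationOn (G.tilePath t a b) (uIcc r₁ r₂) ≤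
        eVariationOn (G.tilePath t a b) (Icc 0 1) := by
    intro n
    induction n with
    | zero =>
      intro t z₁ z₂ _ _ a b _ r₁ hr₁ r₂ hr₂ _ _
      rw [pow_zero, one_mul]
      exact eVariationOn.mono _ (uIcc_subset_Icc hr₁ hr₂)
    | succ n ih =>
      rintro t _ _ hq hne a b hab r₁ hr₁ r₂ hr₂ rfl rfl
      have ht := hQT _ _ _ hq
      obtain ⟨t', hc, hq'⟩ := hQc _ _ _ hq
      have ht' := hQT _ _ _ hq'
      obtain ⟨e', he', hz₁', hz₂'⟩ := hQe _ _ _ hq'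
      have hmem : ∀ r ∈ Icc (0 : ℝ) 1, G.tilePath t a b r ∈ G.tileEdge t s(a, b) := fun r hr => by
        rw [G.tileEdge_eq_image hab]
        exact mem_image_of_mem _ hr
      have hsub' := G.tileEdge_subset_tileSupp (t := t) (e := s(a, b)) hab
      have hsubΓ := tileEdge_subset_gammaSet (G := G) ht (e := s(a, b)) hab
      have hne' := (h.inflatedPsi_injOn ht).ne ⟨hsubΓ (hmem _ hr₁), hsub' (hmem _ hr₁)⟩
        ⟨hsubΓ (hmem _ hr₂), hsub' (hmem _ hr₂)⟩ hne
      induction e' with | _ c d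
      have hcd : (K t'.1).Adj c d := he'
      have hsub : G.tilePath t' c d '' Icc 0 1 ⊆
          (fun s => σ.lam ^ N • S.tilePath t a b s) '' Icc 0 1 := by
        by_cases hv₁ : ∀ v, inflatedPsi σ T N G S (G.tilePath t a b r₁) ≠ G.tileVertex t' v
        · exact h.tilePath_image_subset ht hc hab hcd (hmem _ hr₁) hz₁' hv₁
        by_cases hv₂ : ∀ v, inflatedPsi σ T N G S (G.tilePath t a b r₂) ≠ G.tileVertex t' v
        · exact h.tilePath_image_subset ht hc hab hcd (hmem _ hr₂) hz₂' hv₂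
        exfalso
        push Not at hv₁ hv₂
        obtain ⟨u₁, hu₁⟩ := hv₁
        obtain ⟨u₂, hu₂⟩ := hv₂
        have hadj : (K t'.1).Adj u₁ u₂ := by
          have m₁ := G.mem_of_tileVertex_mem_tileEdge he' (hu₁ ▸ hz₁')
          have m₂ := G.mem_of_tileVertex_mem_tileEdge he' (hu₂ ▸ hz₂')
          have hu : u₁ ≠ u₂ := fun hu => hne' (by rw [hu₁, hu₂, hu])
          rwa [(Sym2.mem_and_mem_iff hu).1 ⟨m₁, m₂⟩] at he'
        rw [hu₁, hu₂] at hq'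
        obtain ⟨t'', hc', hq''⟩ := hQc _ _ _ hq'
        obtain ⟨e'', he'', m₁, m₂⟩ := hQe _ _ _ hq''
        exact h.notMem_child_of_adj ht' hc' hadj (G.tileEdge_subset_tileSupp he'' m₁)
          (G.tileEdge_subset_tileSupp he'' m₂)
      rw [G.tileEdge_eq_image hcd] at hz₁' hz₂'
      obtain ⟨s₁, hs₁, hsz₁⟩ := hz₁'
      obtain ⟨s₂, hs₂, hsz₂⟩ := hz₂'
      have hIH := ih t' _ _ hq' hne' c d hcd s₁ hs₁ s₂ hs₂ hsz₁ hsz₂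
      have hgi := injOn_smul_tilePath σ N S hab
      obtain ⟨θ, hθm, hθ, hθv⟩ := exists_reparametrization (G.continuousOn_tilePath hcd)
        (G.injOn_tilePath hcd) (continuousOn_smul_tilePath σ N S hab) hgi hsub
      have hθ₁ : θ s₁ = r₁ := hgi (hθm hs₁) hr₁
        ((hθ s₁ hs₁).trans (hsz₁.trans (h.inflatedPsi_tilePath ht hab hr₁)))
      have hθ₂ : θ s₂ = r₂ := hgi (hθm hs₂) hr₂
        ((hθ s₂ hs₂).trans (hsz₂.trans (h.inflatedPsi_tilePath ht hab hr₂)))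
      obtain ⟨hfin, k, hk⟩ := h.exists_speed t hab
      rw [hθv s₁ hs₁ s₂ hs₂, hθ₁, hθ₂, hk r₁ hr₁ r₂ hr₂] at hIH
      have hr := hratio t ht t' hc a b hab c d hcd hsub
      have hk01 := hk 0 (left_mem_Icc.2 zero_le_one) 1 (right_mem_Icc.2 zero_le_one)
      rw [uIcc_of_le zero_le_one] at hk01
      rw [hk01] at hr
      have hk0 : (k : ENNReal) ≠ 0 := by
        intro hk0
        rw [hk0, zero_mul, nonpos_iff_eq_zero, mul_eq_zero] at hr
        rcases hr with hr | hr
        · exact (zero_lt_one.trans hρ).ne' hr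
        · exact (eVariationOn_pos (G.injOn_tilePath hcd) le_rfl one_pos le_rfl).ne' hr
      rw [← ENNReal.mul_le_mul_iff_right hk0 ENNReal.coe_ne_top]
      calc (k : ENNReal) * (ρ ^ (n + 1) * eVariationOn (G.tilePath t a b) (uIcc r₁ r₂))
          = ρ * (ρ ^ n * (k * eVariationOn (G.tilePath t a b) (uIcc r₁ r₂))) := by ring
        _ ≤ ρ * eVariationOn (G.tilePath t' c d) (Icc 0 1) := by gcongr
        _ ≤ _ := hr
  by_contra hne
  obtain ⟨e, he, hz₁, hz₂⟩ := hQe _ _ _ hQ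
  induction e with | _ a b
  have hab : (K t.1).Adj a b := he
  rw [G.tileEdge_eq_image hab] at hz₁ hz₂
  obtain ⟨r₁, hr₁, rfl⟩ := hz₁
  obtain ⟨r₂, hr₂, rfl⟩ := hz₂
  have hr : r₁ ≠ r₂ := fun hr => hne (by rw [hr])
  have hpos : 0 < eVariationOn (G.tilePath t a b) (uIcc r₁ r₂) :=
    eVariationOn_pos (G.injOn_tilePath hab) (le_inf hr₁.1 hr₂.1) (inf_lt_sup.2 hr)
      (sup_le hr₁.2 hr₂.2)
  have hfin := (h.exists_speed t hab).1
  have hlim := ENNReal.tendsto_pow_atTop_nhds_top_iff.2 hρ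
  have hdiv : eVariationOn (G.tilePath t a b) (Icc 0 1) /
      eVariationOn (G.tilePath t a b) (uIcc r₁ r₂) < ⊤ := ENNReal.div_lt_top hfin hpos.ne'
  obtain ⟨n, hn⟩ := (hlim.eventually_const_lt hdiv).exists
  rw [ENNReal.div_lt_iff (Or.inl hpos.ne') (Or.inr hfin)] at hn
  · exact absurd (key n t _ _ hQ hne a b hab r₁ hr₁ r₂ hr₂ rfl rfl) (not_le.2 hn)

end IsInjectivePair

end GeomGraph

end FractalTiling

namespace FractalTiling

namespace GeomGraph

variable {P : Type*} {Pt : PrototileSet P} {T : Set (P × Plane)} {σ : Substitution Pt}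
  {V : P → Type*} [∀ p, Fintype (V p)] {K : ∀ p, SimpleGraph (V p)} {N : ℕ} {G S : GeomGraph Pt K}

theorem IsChild.mem_of_smul_mem {t t' : P × Plane} (hc : IsChild σ N t t') {z : Plane}
    (hz : σ.lam ^ N • z ∈ tileSupp Pt t') : z ∈ tileSupp Pt t := by
  obtain ⟨s, hs, rfl⟩ := hc
  rw [mem_tileSupp]
  exact subtileSupp_subset hs (mem_tileSupp_inflatedSubtile.1 (by rwa [sub_add_cancel]))

theorem exists_isChild (σ : Substitution Pt) (N : ℕ) {t : P × Plane} {z : Plane}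
    (hz : z ∈ tileSupp Pt t) : ∃ t', IsChild σ N t t' ∧ σ.lam ^ N • z ∈ tileSupp Pt t' := by
  obtain ⟨s, hs, hzs⟩ := exists_subtile (σ := σ) (N := N) (mem_tileSupp.1 hz)
  refine ⟨_, ⟨s, hs, rfl⟩, ?_⟩
  have := (mem_tileSupp_inflatedSubtile (t := t)).2 hzs
  rwa [sub_add_cancel] at this

/-- The points `z₁` and `z₂` of the tile `t` have the same image under `ψ⁽∞⁾`. -/
structure IsCollision (σ : Substitution Pt) (T : Set (P × Plane)) (N : ℕ) (G S : GeomGraph Pt K)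
    (t : P × Plane) (z₁ z₂ : Plane) : Prop where
  mem : t ∈ T
  left : z₁ ∈ G.gammaSet T ∩ tileSupp Pt t
  right : z₂ ∈ G.gammaSet T ∩ tileSupp Pt t
  eq : psiLim σ T N G S z₁ = psiLim σ T N G S z₂

theorem IsCollision.symm {t : P × Plane} {z₁ z₂ : Plane} (hR : IsCollision σ T N G S t z₁ z₂) :
    IsCollision σ T N G S t z₂ z₁ := ⟨hR.mem, hR.right, hR.left, hR.eq.symm⟩

/-- Two points lie in a common edge of the tile `t`. -/
def HaveCommonEdge (G : GeomGraph Pt K) (t : P × Plane) (z₁ z₂ : Plane) : Prop :=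
  ∃ e ∈ (K t.1).edgeSet, z₁ ∈ G.tileEdge t e ∧ z₂ ∈ G.tileEdge t e

theorem HaveCommonEdge.symm {t : P × Plane} {z₁ z₂ : Plane} (hC : G.HaveCommonEdge t z₁ z₂) :
    G.HaveCommonEdge t z₂ z₁ := by
  obtain ⟨e, he, h₁, h₂⟩ := hC
  exact ⟨e, he, h₂, h₁⟩

namespace IsInjectivePair

variable [Finite P]

/-! ### The limit map and the boundaries of the tiles -/

theorem exists_boundaryVertex_of_psiLim_mem_frontier (h : IsInjectivePair σ T N G S)
    {t : P × Plane} (ht : t ∈ T) {e : Sym2 (V t.1)} (he : e ∈ (K t.1).edgeSet) {z : Plane}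
    (hz : z ∈ G.tileEdge t e) (hf : psiLim σ T N G S z ∈ frontier (tileSupp Pt t)) :
    ∃ b ∈ e, G.IsBoundaryVertex t.1 b ∧
      ∀ s ∈ T, psiLim σ T N G S z ∈ tileSupp Pt s → G.tileVertex t b ∈ tileSupp Pt s := by
  have hzΓ := tileEdge_subset_gammaSet ht he hz
  obtain ⟨w, hw, rfl⟩ := hz
  have hwr := cell_subset_realization he hw
  obtain ⟨s, hs, hws⟩ := exists_subtile (σ := σ) (N := N) (S.mapsTo _ hwr)
  have hy := h.psiLim_sub_mem_subtileSupp ht hs hzΓ ((h.inflatedPsi_mem_tileSupp_iff ht hwr).2 hws)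
  obtain ⟨b, hbe, hb, o, ho, hbo, hyo⟩ := h.exists_boundaryVertex_of_mem_frontier he
    (mem_subpatchSupp hs hws ⟨w, hw, rfl⟩ hy) (mem_frontier_tileSupp.1 hf)
  refine ⟨b, hbe, hb, fun r hr hzr => ?_⟩
  exact ho.add_mem_tileSupp h.tiling ht hr hyo (by rwa [sub_add_cancel]) hbo

theorem psiLim_tileVertex_notMem_frontier (h : IsInjectivePair σ T N G S)
    {t : P × Plane} (ht : t ∈ T) {v : V t.1} (hv : ¬ G.IsBoundaryVertex t.1 v) :
    psiLim σ T N G S (G.tileVertex t v) ∉ frontier (tileSupp Pt t) := by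
  intro hf
  have hvr := G.vertexCoord_mem_realization t.1 v
  obtain ⟨s, hs, hvs⟩ := exists_subtile (σ := σ) (N := N) (S.mapsTo _ hvr)
  have hy := h.psiLim_sub_mem_subtileSupp ht hs (tileVertex_mem_gammaSet ht v)
    ((h.inflatedPsi_mem_tileSupp_iff ht hvr).2 hvs)
  exact (mem_frontier_tileSupp.1 hf).2 (h.subtileSupp_subset_interior hv hs hvs hy)

/-- Only the boundary vertices of a tile are mapped to its boundary by `ψ⁽∞⁾`. -/
theorem eq_tileVertex_of_psiLim_mem_frontier (h : IsInjectivePair σ T N G S) {t : P × Plane}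
    (ht : t ∈ T) {e : Sym2 (V t.1)} (he : e ∈ (K t.1).edgeSet) {z : Plane}
    (hz : z ∈ G.tileEdge t e) (hf : psiLim σ T N G S z ∈ frontier (tileSupp Pt t)) {b : V t.1}
    (hb : b ∈ e) (hbb : G.IsBoundaryVertex t.1 b) : z = G.tileVertex t b := by
  refine h.eq_of_common_edges (fun t z₁ z₂ => t ∈ T ∧
      psiLim σ T N G S z₁ ∈ frontier (tileSupp Pt t) ∧ ∃ e ∈ (K t.1).edgeSet, z₁ ∈ G.tileEdge t e ∧
        ∃ b ∈ e, G.IsBoundaryVertex t.1 b ∧ z₂ = G.tileVertex t b)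
    (fun _ _ _ hq => hq.1) ?_ ?_ (t := t) ⟨ht, hf, e, he, hz, b, hb, hbb, rfl⟩
  · rintro t z₁ _ ⟨ht, -, e, he, hz, b, hb, -, rfl⟩
    exact ⟨e, he, hz, G.tileVertex_mem_tileEdge hb⟩
  clear hbb hb hf hz he ht
  rintro t z _ ⟨ht, hf, e, he, hz, b, hb, hbb, rfl⟩
  have hzΓ := tileEdge_subset_gammaSet ht he hz
  obtain ⟨s, hs, hzs⟩ := h.exists_inflatedSubtile ht hzΓ (G.tileEdge_subset_tileSupp he hz)
  have hc : IsChild σ N t (inflatedSubtile σ N t s) := ⟨s, hs, rfl⟩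
  generalize inflatedSubtile σ N t s = t' at hc hzs
  have ht' := h.child_mem ht hc
  have hlim := h.psiLim_inflatedPsi hzΓ
  have hmem := h.psiLim_mem_tileSupp ht' (h.mapsTo hzΓ) hzs
  have hf' : psiLim σ T N G S (inflatedPsi σ T N G S z) ∈ frontier (tileSupp Pt t') := by
    rw [(isClosed_tileSupp t').frontier_eq]
    refine ⟨hmem, fun hi => (mem_frontier_tileSupp.1 hf).2 (hc.mem_interior ?_)⟩
    rwa [sub_add_cancel, ← hlim]
  refine ⟨t', hc, ht', hf', ?_⟩
  obtain ⟨e', he', hze'⟩ := h.recurrent.consistent_left.exists_mem_tileEdge h.tiling ht'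
    (h.mapsTo hzΓ) hzs
  obtain ⟨b', hb', hbb', htiles⟩ := h.exists_boundaryVertex_of_psiLim_mem_frontier ht' he' hze' hf'
  refine ⟨e', he', hze', b', hb', hbb', ?_⟩
  obtain ⟨z₀, hz₀, hz₀b⟩ : G.tileVertex t' b' ∈ inflatedPsi σ T N G S '' G.tileEdge t e := by
    by_cases hv : ∀ v, inflatedPsi σ T N G S z ≠ G.tileVertex t' v
    · exact h.tileEdge_subset_image ht hc he he' hz hze' hv (G.tileVertex_mem_tileEdge hb')
    · push Not at hv
      obtain ⟨u, hu⟩ := hv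
      rw [hu] at hf' hze'
      have hub : G.IsBoundaryVertex t'.1 u := by
        by_contra hub
        exact h.psiLim_tileVertex_notMem_frontier ht' hub hf'
      rw [h.eq_of_isBoundaryVertex he' hb' (G.mem_of_tileVertex_mem_tileEdge he' hze') hbb' hub,
        ← hu]
      exact mem_image_of_mem _ hz
  obtain ⟨w, hw, rfl⟩ := hz₀
  have hwr := cell_subset_realization he hw
  rw [h.inflatedPsi_eq ht hwr] at hz₀b
  obtain ⟨r, hr, hrt, hzr⟩ := h.tiling.exists_ne_of_mem_frontier hf
  obtain ⟨r', hcr, hzr'⟩ := exists_isChild σ N hzr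
  rw [← hlim] at hzr'
  have hwf : S.ι t.1 w ∈ frontier (Pt.supp t.1) := by
    have := mem_frontier_of_mem_of_mem h.tiling ht hr hrt.symm (S.add_mem_tileSupp hwr)
      (hcr.mem_of_smul_mem (hz₀b ▸ htiles r' (h.child_mem hr hcr) hzr'))
    rwa [mem_frontier_tileSupp, add_sub_cancel_right] at this
  obtain ⟨v, rfl, hv⟩ := h.recurrent.consistent_right.exists_vertexCoord hwr hwf
  obtain rfl := h.eq_of_isBoundaryVertex he hb (vertexCoord_mem_cell_iff.1 hw) hbb
    ((h.recurrent.boundary_iff _ _).2 hv)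
  rw [← hz₀b]
  exact h.inflatedPsi_tileVertex ht b

/-- The limit map `ψ⁽∞⁾` does not move points into further tiles. -/
theorem mem_tileSupp_of_psiLim_mem (h : IsInjectivePair σ T N G S) {s t : P × Plane} (hs : s ∈ T)
    (ht : t ∈ T) {z : Plane} (hz : z ∈ G.gammaSet T ∩ tileSupp Pt s)
    (hzt : psiLim σ T N G S z ∈ tileSupp Pt t) : z ∈ tileSupp Pt t := by
  by_cases hst : s = t
  · exact hst ▸ hz.2
  have hf := mem_frontier_of_mem_of_mem h.tiling hs ht hst (h.psiLim_mem_tileSupp hs hz.1 hz.2) hzt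
  obtain ⟨e, he, hze⟩ := h.recurrent.consistent_left.exists_mem_tileEdge h.tiling hs hz.1 hz.2
  obtain ⟨b, hbe, hb, htiles⟩ := h.exists_boundaryVertex_of_psiLim_mem_frontier hs he hze hf
  rw [h.eq_tileVertex_of_psiLim_mem_frontier hs he hze hf hbe hb]
  exact htiles t ht hzt

/-! ### Injectivity of the limit map -/

theorem exists_collision_child (h : IsInjectivePair σ T N G S) {t : P × Plane} {z₁ z₂ : Plane}
    (hR : IsCollision σ T N G S t z₁ z₂) : ∃ t', IsChild σ N t t' ∧
      IsCollision σ T N G S t' (inflatedPsi σ T N G S z₁) (inflatedPsi σ T N G S z₂) := by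
  obtain ⟨s₁, hs₁, hz₁⟩ := h.exists_inflatedSubtile hR.mem hR.left.1 hR.left.2
  obtain ⟨s₂, hs₂, hz₂⟩ := h.exists_inflatedSubtile hR.mem hR.right.1 hR.right.2
  have ht₁ := inflatedSubtile_mem h.selfSimilar hR.mem hs₁
  have ht₂ := inflatedSubtile_mem h.selfSimilar hR.mem hs₂
  have heq : psiLim σ T N G S (inflatedPsi σ T N G S z₁) =
      psiLim σ T N G S (inflatedPsi σ T N G S z₂) := by
    rw [h.psiLim_inflatedPsi hR.left.1, h.psiLim_inflatedPsi hR.right.1, hR.eq]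
  refine ⟨_, ⟨s₁, hs₁, rfl⟩, ht₁, ⟨h.mapsTo hR.left.1, hz₁⟩, ⟨h.mapsTo hR.right.1, ?_⟩, heq⟩
  refine h.mem_tileSupp_of_psiLim_mem ht₂ ht₁ ⟨h.mapsTo hR.right.1, hz₂⟩ ?_
  rw [← heq]
  exact h.psiLim_mem_tileSupp ht₁ (h.mapsTo hR.left.1) hz₁

theorem ne_tileVertex_of_not_haveCommonEdge (h : IsInjectivePair σ T N G S) {t : P × Plane}
    {z₁ z₂ : Plane} (hR : IsCollision σ T N G S t z₁ z₂) (hC : ¬ G.HaveCommonEdge t z₁ z₂)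
    (u : V t.1) : z₁ ≠ G.tileVertex t u := by
  rintro rfl
  obtain ⟨_, ⟨s, hs, rfl⟩, hR'⟩ := h.exists_collision_child hR
  obtain ⟨f, hf, w, hw, rfl⟩ := h.recurrent.consistent_left.exists_mem_tileEdge h.tiling hR.mem
    hR.right.1 hR.right.2
  refine h.not_mem_subtileSupp_of_notMem hf (fun hu => hC ?_) hs
    ((h.inflatedPsi_mem_tileSupp_iff hR.mem (G.vertexCoord_mem_realization _ u)).1 hR'.left.2) hw
    ((h.inflatedPsi_mem_tileSupp_iff hR.mem (cell_subset_realization hf hw)).1 hR'.right.2)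
  exact ⟨f, hf, G.tileVertex_mem_tileEdge hu, w, hw, rfl⟩

theorem exists_adjacent_edges (h : IsInjectivePair σ T N G S) {t : P × Plane}
    {z₁ z₂ : Plane} (hR : IsCollision σ T N G S t z₁ z₂) (hC : ¬ G.HaveCommonEdge t z₁ z₂) :
    ∃ e₁ ∈ (K t.1).edgeSet, ∃ e₂ ∈ (K t.1).edgeSet, z₁ ∈ G.tileEdge t e₁ ∧ z₂ ∈ G.tileEdge t e₂ ∧
      ∃ v, v ∈ e₁ ∧ v ∈ e₂ := by
  obtain ⟨_, ⟨s, hs, rfl⟩, hR'⟩ := h.exists_collision_child hR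
  have hG := h.recurrent.consistent_left
  obtain ⟨e, he, w, hw, rfl⟩ := hG.exists_mem_tileEdge h.tiling hR.mem hR.left.1 hR.left.2
  obtain ⟨f, hf, u, hu, rfl⟩ := hG.exists_mem_tileEdge h.tiling hR.mem hR.right.1 hR.right.2
  have hne : e ≠ f := by
    rintro rfl
    exact hC ⟨e, he, ⟨w, hw, rfl⟩, u, hu, rfl⟩
  obtain ⟨v, hve, hvf, -, -⟩ := h.exists_common_vertex he hf hne
    (mem_subpatch hs ((h.inflatedPsi_mem_tileSupp_iff hR.mem
      (cell_subset_realization he hw)).1 hR'.left.2) ⟨w, hw, rfl⟩)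
    (mem_subpatch hs ((h.inflatedPsi_mem_tileSupp_iff hR.mem
      (cell_subset_realization hf hu)).1 hR'.right.2) ⟨u, hu, rfl⟩)
  exact ⟨e, he, f, hf, ⟨w, hw, rfl⟩, ⟨u, hu, rfl⟩, v, hve, hvf⟩

theorem haveCommonEdge_of_child_of_forall_ne (h : IsInjectivePair σ T N G S) {t t' : P × Plane}
    (hc : IsChild σ N t t') {z₁ z₂ : Plane} (hR : IsCollision σ T N G S t z₁ z₂)
    (hC : G.HaveCommonEdge t' (inflatedPsi σ T N G S z₁) (inflatedPsi σ T N G S z₂))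
    (hv : ∀ v, inflatedPsi σ T N G S z₁ ≠ G.tileVertex t' v) : G.HaveCommonEdge t z₁ z₂ := by
  obtain ⟨f, hf, h₁, h₂⟩ := hC
  obtain ⟨e, he, hze⟩ := h.recurrent.consistent_left.exists_mem_tileEdge h.tiling hR.mem
    hR.left.1 hR.left.2
  obtain ⟨z₀, hz₀, heq⟩ := h.tileEdge_subset_image hR.mem hc he hf hze h₁ hv h₂
  obtain rfl := h.inflatedPsi_injOn hR.mem
    ⟨tileEdge_subset_gammaSet hR.mem he hz₀, G.tileEdge_subset_tileSupp he hz₀⟩ hR.right heq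
  exact ⟨e, he, hze, hz₀⟩

/-- Points without a common edge, but with the same image under `ψ⁽∞⁾`, stay without common
edges. -/
theorem not_haveCommonEdge_child (h : IsInjectivePair σ T N G S) {t t' : P × Plane}
    (hc : IsChild σ N t t') {z₁ z₂ : Plane} (hR : IsCollision σ T N G S t z₁ z₂)
    (hR' : IsCollision σ T N G S t' (inflatedPsi σ T N G S z₁) (inflatedPsi σ T N G S z₂))
    (hC : ¬ G.HaveCommonEdge t z₁ z₂) :
    ¬ G.HaveCommonEdge t' (inflatedPsi σ T N G S z₁) (inflatedPsi σ T N G S z₂) := by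
  intro hC'
  by_cases hv₁ : ∀ v, inflatedPsi σ T N G S z₁ ≠ G.tileVertex t' v
  · exact hC (h.haveCommonEdge_of_child_of_forall_ne hc hR hC' hv₁)
  by_cases hv₂ : ∀ v, inflatedPsi σ T N G S z₂ ≠ G.tileVertex t' v
  · exact hC (h.haveCommonEdge_of_child_of_forall_ne hc hR.symm hC'.symm hv₂).symm
  push Not at hv₁ hv₂
  obtain ⟨u₁, hu₁⟩ := hv₁
  obtain ⟨u₂, hu₂⟩ := hv₂
  obtain ⟨f, hf, h₁, h₂⟩ := hC'
  have hu : u₁ ≠ u₂ := by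
    rintro rfl
    obtain rfl := h.inflatedPsi_injOn hR.mem hR.left hR.right (hu₁.trans hu₂.symm)
    obtain ⟨e, he, hze⟩ := h.recurrent.consistent_left.exists_mem_tileEdge h.tiling hR.mem
      hR.left.1 hR.left.2
    exact hC ⟨e, he, hze, hze⟩
  rw [hu₁] at h₁ hR'
  rw [hu₂] at h₂ hR'
  have hadj : s(u₁, u₂) ∈ (K t'.1).edgeSet := by
    rwa [← (Sym2.mem_and_mem_iff hu).1 ⟨G.mem_of_tileVertex_mem_tileEdge hf h₁,
      G.mem_of_tileVertex_mem_tileEdge hf h₂⟩]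
  obtain ⟨t'', hc', hR''⟩ := h.exists_collision_child hR'
  exact h.notMem_child_of_adj hR'.mem hc' hadj hR''.left.2 hR''.right.2

theorem haveCommonEdge_of_isCollision (h : IsInjectivePair σ T N G S) {t : P × Plane}
    {z₁ z₂ : Plane} (hR : IsCollision σ T N G S t z₁ z₂) : G.HaveCommonEdge t z₁ z₂ := by
  by_contra hC
  obtain ⟨e₁, he₁, e₂, he₂, hz₁, hz₂, v, hv₁, hv₂⟩ := h.exists_adjacent_edges hR hC
  have heq : z₁ = G.tileVertex t v := by
    refine h.eq_of_common_edges (fun t z₁ y => ∃ z₂, IsCollision σ T N G S t z₁ z₂ ∧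
        ¬ G.HaveCommonEdge t z₁ z₂ ∧ ∃ e₁ ∈ (K t.1).edgeSet, ∃ e₂ ∈ (K t.1).edgeSet,
        z₁ ∈ G.tileEdge t e₁ ∧ z₂ ∈ G.tileEdge t e₂ ∧ ∃ v, v ∈ e₁ ∧ v ∈ e₂ ∧ y = G.tileVertex t v)
      (fun _ _ _ hq => hq.choose_spec.1.mem) ?_ ?_ (t := t)
      ⟨z₂, hR, hC, e₁, he₁, e₂, he₂, hz₁, hz₂, v, hv₁, hv₂, rfl⟩
    · rintro t z₁ _ ⟨z₂, -, -, e₁, he₁, -, -, hz₁, -, v, hv₁, -, rfl⟩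
      exact ⟨e₁, he₁, hz₁, G.tileVertex_mem_tileEdge hv₁⟩
    clear hv₁ hv₂ hz₁ hz₂ he₁ he₂ hC hR
    rintro t z₁ _ ⟨z₂, hR, hC, e₁, he₁, e₂, he₂, hz₁, hz₂, v, hv₁, hv₂, rfl⟩
    obtain ⟨t', hc, hR'⟩ := h.exists_collision_child hR
    have hC' := h.not_haveCommonEdge_child hc hR hR' hC
    obtain ⟨f₁, hf₁, f₂, hf₂, hy₁, hy₂, u, hu₁, hu₂⟩ := h.exists_adjacent_edges hR' hC'
    refine ⟨t', hc, _, hR', hC', f₁, hf₁, f₂, hf₂, hy₁, hy₂, u, hu₁, hu₂, ?_⟩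
    obtain ⟨x₁, hx₁, hxu₁⟩ := h.tileEdge_subset_image hR.mem hc he₁ hf₁ hz₁ hy₁
      (h.ne_tileVertex_of_not_haveCommonEdge hR' hC') (G.tileVertex_mem_tileEdge hu₁)
    obtain ⟨x₂, hx₂, hxu₂⟩ := h.tileEdge_subset_image hR.mem hc he₂ hf₂ hz₂ hy₂
      (h.ne_tileVertex_of_not_haveCommonEdge hR'.symm fun hh => hC' hh.symm)
      (G.tileVertex_mem_tileEdge hu₂)
    obtain rfl := h.inflatedPsi_injOn hR.mem
      ⟨tileEdge_subset_gammaSet hR.mem he₁ hx₁, G.tileEdge_subset_tileSupp he₁ hx₁⟩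
      ⟨tileEdge_subset_gammaSet hR.mem he₂ hx₂, G.tileEdge_subset_tileSupp he₂ hx₂⟩
      (hxu₁.trans hxu₂.symm)
    have hne : e₁ ≠ e₂ := by
      rintro rfl
      exact hC ⟨e₁, he₁, hz₁, hz₂⟩
    obtain ⟨v', hv'₁, hv'₂, rfl⟩ := G.exists_eq_tileVertex_of_mem_tileEdge he₁ he₂ hne hx₁ hx₂
    have hvv' : v' = v := by
      by_contra hvv'
      exact hne (((Sym2.mem_and_mem_iff hvv').1 ⟨hv'₁, hv₁⟩).trans
        ((Sym2.mem_and_mem_iff hvv').1 ⟨hv'₂, hv₂⟩).symm)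
    rw [← hvv', hxu₁]
  exact hC ⟨e₂, he₂, heq ▸ G.tileVertex_mem_tileEdge hv₂, hz₂⟩

theorem injOn_psiLim (h : IsInjectivePair σ T N G S) :
    InjOn (psiLim σ T N G S) (G.gammaSet T) := by
  intro z₁ hz₁ z₂ hz₂ heq
  obtain ⟨t₁, ht₁, hzt₁⟩ := h.tiling.exists_mem z₁
  obtain ⟨t₂, ht₂, hzt₂⟩ := h.tiling.exists_mem z₂
  have hz₂t₁ : z₂ ∈ tileSupp Pt t₁ := h.mem_tileSupp_of_psiLim_mem ht₂ ht₁ ⟨hz₂, hzt₂⟩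
    (heq ▸ h.psiLim_mem_tileSupp ht₁ hz₁ hzt₁)
  exact h.eq_of_common_edges (IsCollision σ T N G S) (fun _ _ _ hR => hR.mem)
    (fun _ _ _ hR => h.haveCommonEdge_of_isCollision hR)
    (fun _ _ _ hR => h.exists_collision_child hR)
    ⟨ht₁, ⟨hz₁, hzt₁⟩, ⟨hz₂, hz₂t₁⟩, heq⟩

end IsInjectivePair

end GeomGraph

end FractalTiling

theorem proposition5p1 {P : Type*} [Finite P] (Pt : FractalTiling.PrototileSet P)
    (T : Set (P × Plane)) (hT : FractalTiling.IsTiling Pt T) (hFLC : FractalTiling.IsFLC Pt T)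
    (σ : FractalTiling.Substitution Pt) (hσ : FractalTiling.IsSelfSimilar σ T)
    {V : P → Type*} [∀ p, Fintype (V p)] (K : ∀ p, SimpleGraph (V p))
    (G S : FractalTiling.GeomGraph Pt K) (N : ℕ)
    (hrec : FractalTiling.GeomGraph.IsRecurrentPair σ T N G S)
    (hdual : G.IsQuasiDual T)
    (hspeed : FractalTiling.GeomGraph.IsConstantSpeed G S)
    (hinj : FractalTiling.GeomGraph.InjectivityConditions σ T N S) :
    -- the map `ψ` is well defined on `∂T⁽⁰⁾`
    (∀ t ∈ T, ∀ z ∈ G.gammaSet T ∩ FractalTiling.tileSupp Pt t,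
      z - t.2 ∈ G.carrier t.1 ∧
        FractalTiling.GeomGraph.psi T G S z =
          FractalTiling.GeomGraph.psiTilde G S t.1 (z - t.2) + t.2) ∧
    -- the map `λ^N ψ` can be iterated
    MapsTo (FractalTiling.GeomGraph.inflatedPsi σ T N G S) (G.gammaSet T) (G.gammaSet T) ∧
    -- the limit exists
    (∀ z ∈ G.gammaSet T,
      Tendsto (fun n => FractalTiling.GeomGraph.psiIter σ T N G S n z) atTop
        (𝓝 (FractalTiling.GeomGraph.psiLim σ T N G S z))) ∧
    -- and it is injective
    InjOn (FractalTiling.GeomGraph.psiLim σ T N G S) (G.gammaSet T) := by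
  have h : FractalTiling.GeomGraph.IsInjectivePair σ T N G S := ⟨hT, hσ, hrec, hdual, hspeed, hinj⟩
  refine ⟨?_, h.mapsTo, fun z hz => h.tendsto_psiLim hz, h.injOn_psiLim⟩
  rintro t ht z ⟨hz, hzt⟩
  obtain ⟨w, hw, rfl⟩ := hrec.consistent_left.exists_eq_add hT ht hz hzt
  rw [h.psi_eq ht hw, add_sub_cancel_right, FractalTiling.GeomGraph.psiTilde_ι hw]
  exact ⟨⟨w, hw, rfl⟩, rfl⟩
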